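/- Let $\mathrm{SV}=\mathbb C[\partial]L\oplus\mathbb C[\partial]M\oplus\mathbb C[\partial]Y$ be the Schrödinger–Virasoro Lie conformal algebra, with $\lambda$-brackets $[L_\lambda L]=(\partial+2\lambda)L$, $[L_\lambda Y]=(\partial+\frac32\lambda)Y$, $[L_\lambda M]=(\partial+\lambda)M$, $[Y_\lambda Y]=(\partial+2\lambda)M$, $[Y_\lambda M]=[M_\lambda M]=0$. For $\alpha\in\mathbb C$ and $\Delta\in\mathbb C\setminus\{0\}$ let $V(\alpha,\Delta)=\mathbb C[\partial]v_\Delta$ be the conformal $\mathrm{SV}$-module with $L_\lambda v_\Delta=(\partial+\alpha+\Delta\lambda)v_\Delta$ and $M_\lambda v_\Delta=Y_\lambda v_\Delta=0$. An extension is trivial if it is equivalent to the direct sum. Let $\alpha,\bar\alpha\in\mathbb C$ and $\Delta,\bar\Delta\in\mathbb C\setminus\{0\}$. A nontrivial extension of conformal $\mathrm{SV}$-modules $$0\to V(\bar\alpha,\bar\Delta)\to E\to V(\alpha,\Delta)\to0$$ exists only if $\alpha=\bar\alpha$ and $\Delta-\bar\Delta\in\{0,2,3,4,5,6,\pm\frac12,\frac32\}$.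 When $\alpha=\bar\alpha$, put $\bar\partial=\partial+\alpha$. Every nontrivial extension is equivalent to one on $\mathbb C[\partial]v_{\bar\Delta}\oplus\mathbb C[\partial]v_\Delta$ with $$L_\lambda v_\Delta=(\partial+\alpha+\Delta\lambda)v_\Delta+f(\partial,\lambda)v_{\bar\Delta},\quad M_\lambda v_\Delta=g(\partial,\lambda)v_{\bar\Delta},\quad Y_\lambda v_\Delta=h(\partial,\lambda)v_{\bar\Delta},$$ where $(\Delta,\bar\Delta)$ and $(f,g,h)$ are in the following list; conversely, every entry of the list (with $\Delta,\bar\Delta\ne0$ and $\alpha=\bar\alpha$) defines an extension, and it is nontrivial. (i) $g=h=0$ and, with $c\in\mathbb C\setminus\{0\}$, one of: (a) $\Delta=\bar\Delta$, $f=c_0+c_1\lambda$ with $(c_0,c_1)\neq(0,0)$; (b) $\Delta-\bar\Delta=2$, $f=c\,\lambda^2(2\bar\partial+\lambda)$; (c) $\Delta-\bar\Delta=3$, $f=c\,\bar\partial\lambda^2(\bar\partial+\lambda)$; (d) $\Delta-\bar\Delta=4$, $f=c\,\lambda^2(4\bar\partial^3+6\bar\partial^2\lambda-\bar\partial\lambda^2+\bar\Delta\lambda^3)$;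 (e) $(\Delta,\bar\Delta)=(1,-4)$, $f=c\,(\bar\partial^4\lambda^2-10\bar\partial^2\lambda^4-17\bar\partial\lambda^5-8\lambda^6)$; (f) $(\Delta,\bar\Delta)=(\frac72\pm\frac{\sqrt{19}}2,-\frac52\pm\frac{\sqrt{19}}2)$ with the same sign in both, $f=c\,\big(\bar\partial^4\lambda^3-(2\bar\Delta+3)\bar\partial^3\lambda^4-3\bar\Delta\bar\partial^2\lambda^5-(3\bar\Delta+1)\bar\partial\lambda^6-(\bar\Delta+\frac9{28})\lambda^7\big)$. (ii) $\Delta-\bar\Delta=-\frac12$, $f=g=0$, $h=a_0$ with $a_0\in\mathbb C\setminus\{0\}$. (iii) $\Delta-\bar\Delta=\frac12$, $f=g=0$, $h=a_0(\bar\partial+2\bar\Delta\lambda)$ with $a_0\in\mathbb C\setminus\{0\}$. (iv) $(\Delta,\bar\Delta)=(1,-\frac12)$, $f=g=0$, $h=a_0(\bar\partial^2-\lambda^2)$ with $a_0\in\mathbb C\setminus\{0\}$. -/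

import Mathlib

open Polynomial

noncomputable section

/-! Elements of `V[λ]` are written as polynomial functions `ℂ → V` of `λ`. As `ℂ` is infinite, this
is the same as the polynomial, and an identity of polynomials in `λ, μ` is the same as the
identity for all complex values of `λ, μ`. A `ℂ[∂]`-module is a complex vector space with an
endomorphism `∂`, here called `D`. -/

/-- A Lie conformal algebra structure on the complex vector space `R`;
`bracket l a b` is the value of `[a_λ b] ∈ R[λ]` at `λ = l`. -/
structure LieConformalAlgebra (R : Type*) [AddCommGroup R] [Module ℂ R] where
  /-- the action of `∂` -/
  D : R →ₗ[ℂ] R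
  /-- the `λ`-bracket -/
  bracket : ℂ → R →ₗ[ℂ] R →ₗ[ℂ] R
  bracket_D_left : ∀ l a b, bracket l (D a) b = -(l • bracket l a b)
  bracket_D_right : ∀ l a b, bracket l a (D b) = D (bracket l a b) + l • bracket l a b
  /-- `[b_λ a] = ∑ λ^j c_j` is a polynomial in `λ`, and
  `[a_λ b] = - [b_{-λ-∂} a] = - ∑ (-λ-∂)^j c_j`. -/
  skew : ∀ a b, ∃ (n : ℕ) (c : ℕ → R),
    (∀ m : ℂ, bracket m b a = ∑ j ∈ Finset.range n, m ^ j • c j) ∧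
    (∀ l : ℂ, bracket l a b =
      -∑ j ∈ Finset.range n, ((-(l • LinearMap.id) - D : Module.End ℂ R) ^ j) (c j))
  jacobi : ∀ l m a b c, bracket l a (bracket m b c) =
    bracket (l + m) (bracket l a b) c + bracket m b (bracket l a c)

/-- A conformal module structure on `V` over the Lie conformal algebra `A`;
`act l a v` is the value of `a_λ v ∈ V[λ]` at `λ = l`. -/
structure ConformalModule {R : Type*} [AddCommGroup R] [Module ℂ R] (A : LieConformalAlgebra R)
    (V : Type*) [AddCommGroup V] [Module ℂ V] where
  /-- the action of `∂` -/
  D : V →ₗ[ℂ] V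
  /-- the `λ`-action -/
  act : ℂ → R →ₗ[ℂ] V →ₗ[ℂ] V
  act_poly : ∀ a v, ∃ (n : ℕ) (c : ℕ → V),
    ∀ l : ℂ, act l a v = ∑ j ∈ Finset.range n, l ^ j • c j
  act_comm : ∀ l m a b v,
    act l a (act m b v) - act m b (act l a v) = act (l + m) (A.bracket l a b) v
  act_D : ∀ l a v, act l (A.D a) v = -(l • act l a v)
  D_act : ∀ l a v, D (act l a v) - act l a (D v) = -(l • act l a v)

theorem sum_pad {U : Type*} [AddCommGroup U] [Module ℂ U] (k N : ℕ) (hk : k ≤ N) (u : ℕ → U)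
    (l : ℂ) : ∑ j ∈ Finset.range N, l ^ j • (if j < k then u j else 0)
      = ∑ j ∈ Finset.range k, l ^ j • u j := by
  rw [← Finset.sum_subset (Finset.range_mono hk)]
  · exact Finset.sum_congr rfl fun j hj => by rw [if_pos (Finset.mem_range.1 hj)]
  · intro j _ hj
    rw [if_neg (by simpa using hj), smul_zero]

section Extensions

variable {R : Type*} [AddCommGroup R] [Module ℂ R] {A : LieConformalAlgebra R}
  {V : Type*} [AddCommGroup V] [Module ℂ V] {W : Type*} [AddCommGroup W] [Module ℂ W]

/-- Homomorphisms of conformal modules. -/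
def ConformalModule.IsHom (MV : ConformalModule A V) (MW : ConformalModule A W)
    (φ : V →ₗ[ℂ] W) : Prop :=
  (∀ v, φ (MV.D v) = MW.D (φ v)) ∧ ∀ l a v, φ (MV.act l a v) = MW.act l a (φ v)

/-- The direct sum of two conformal modules. -/
def ConformalModule.prod (MV : ConformalModule A V) (MW : ConformalModule A W) :
    ConformalModule A (V × W) where
  D := MV.D.prodMap MW.D
  act l := LinearMap.mk₂ ℂ (fun a x => (MV.act l a x.1, MW.act l a x.2))
    (by intros; simp) (by intros; simp) (by intros; simp) (by intros; simp)
  act_poly a x := by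
    obtain ⟨n, c, hc⟩ := MV.act_poly a x.1
    obtain ⟨n', c', hc'⟩ := MW.act_poly a x.2
    refine ⟨max n n', fun j => (if j < n then c j else 0, if j < n' then c' j else 0), fun l => ?_⟩
    ext
    · simp only [LinearMap.mk₂_apply, Prod.fst_sum, Prod.smul_fst, hc,
        sum_pad n _ (le_max_left n n')]
    · simp only [LinearMap.mk₂_apply, Prod.snd_sum, Prod.smul_snd, hc',
        sum_pad n' _ (le_max_right n n')]
  act_comm l m a b x := by ext <;> simp [MV.act_comm, MW.act_comm]
  act_D l a x := by ext <;> simp [MV.act_D, MW.act_D]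
  D_act l a x := by ext <;> simp [MV.D_act, MW.D_act]

/-- An extension `0 → V → E → W → 0` of conformal modules, on the vector space `E`. -/
structure ConformalExtension (MV : ConformalModule A V) (MW : ConformalModule A W)
    (E : Type*) [AddCommGroup E] [Module ℂ E] where
  /-- the module structure on `E` -/
  toModule : ConformalModule A E
  /-- the map `V → E` -/
  i : V →ₗ[ℂ] E
  /-- the map `E → W` -/
  p : E →ₗ[ℂ] W
  i_hom : MV.IsHom toModule i
  p_hom : toModule.IsHom MW p
  i_injective : Function.Injective i
  p_surjective : Function.Surjective p
  isExact : Function.Exact i p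

variable {MV : ConformalModule A V} {MW : ConformalModule A W}
  {E : Type*} [AddCommGroup E] [Module ℂ E] {E' : Type*} [AddCommGroup E'] [Module ℂ E']

/-- Equivalence of extensions. -/
def ConformalExtension.Equivalent (S : ConformalExtension MV MW E)
    (S' : ConformalExtension MV MW E') : Prop :=
  ∃ ψ : E →ₗ[ℂ] E', S.toModule.IsHom S'.toModule ψ ∧
    (∀ v, ψ (S.i v) = S'.i v) ∧ ∀ e, S'.p (ψ e) = S.p e

/-- The extension `0 → V → V ⊕ W → W → 0`. -/
def ConformalExtension.directSum (MV : ConformalModule A V) (MW : ConformalModule A W) :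
    ConformalExtension MV MW (V × W) where
  toModule := MV.prod MW
  i := LinearMap.inl ℂ V W
  p := LinearMap.snd ℂ V W
  i_hom := by
    constructor <;> intros <;> ext <;> simp [ConformalModule.prod]
  p_hom := by
    constructor <;> intros <;> simp [ConformalModule.prod]
  i_injective := LinearMap.inl_injective
  p_surjective := LinearMap.snd_surjective
  isExact := Function.Exact.inl_snd

/-- An extension is trivial if it is equivalent to the direct sum. -/
def ConformalExtension.IsTrivial (S : ConformalExtension MV MW E) : Prop :=
  S.Equivalent (ConformalExtension.directSum MV MW)

end Extensions

/-! ### The Schrödinger-Virasoro conformal algebra -/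

/-- The generators `L`, `M`, `Y`. -/
inductive SVGen
  | L
  | M
  | Y
  deriving DecidableEq

instance : Fintype SVGen := ⟨{.L, .M, .Y}, by intro x; cases x <;> simp⟩

/-- The free `ℂ[∂]`-module on `L, M, Y`; the variable of `ℂ[X]` is `∂`. -/
abbrev SV : Type := SVGen → ℂ[X]

namespace SV

/-- The generator `x` as an element of `SV`. -/
def gen (x : SVGen) : SV := Pi.single x 1

/-- The polynomial `q(∂, l)` for which `q(∂, λ) z` is the component of `[x_λ y]` along the
generator `z`. Besides the defining brackets
`[L_λ L] = (∂ + 2λ) L`, `[L_λ Y] = (∂ + 3/2 λ) Y`, `[L_λ M] = (∂ + λ) M`, `[Y_λ Y] = (∂ + 2λ) M`,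
these are the ones that skew-symmetry forces,
`[Y_λ L] = (1/2 ∂ + 3/2 λ) Y` and `[M_λ L] = λ M`; all others vanish. -/
def coeff (l : ℂ) : SVGen → SVGen → SVGen → ℂ[X]
  | .L, .L, .L => X + C (2 * l)
  | .L, .Y, .Y => X + C (3 / 2 * l)
  | .L, .M, .M => X + C l
  | .Y, .Y, .M => X + C (2 * l)
  | .Y, .L, .Y => C (1 / 2) * X + C (3 / 2 * l)
  | .M, .L, .M => C l
  | _, _, _ => 0

/-- `[p(∂)x_λ q(∂)y] = p(-λ) q(∂ + λ) [x_λ y]`, extended bilinearly. -/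
def bracketFun (l : ℂ) (a b : SV) : SV := fun z =>
  ∑ x, ∑ y, C ((a x).eval (-l)) * (b y).comp (X + C l) * coeff l x y z

theorem sum_gen {U : Type*} [AddCommMonoid U] (f : SVGen → U) :
    ∑ x, f x = f .L + f .M + f .Y := by
  have : (Finset.univ : Finset SVGen) = {.L, .M, .Y} := rfl
  rw [this]
  simp [add_assoc]

theorem bracketFun_L (l : ℂ) (a b : SV) : bracketFun l a b .L =
    C ((a .L).eval (-l)) * (b .L).comp (X + C l) * (X + C (2 * l)) := by
  simp [bracketFun, sum_gen, coeff]

theorem bracketFun_M (l : ℂ) (a b : SV) : bracketFun l a b .M =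
    C ((a .L).eval (-l)) * (b .M).comp (X + C l) * (X + C l)
    + C ((a .M).eval (-l)) * (b .L).comp (X + C l) * C l
    + C ((a .Y).eval (-l)) * (b .Y).comp (X + C l) * (X + C (2 * l)) := by
  simp [bracketFun, sum_gen, coeff]

theorem bracketFun_Y (l : ℂ) (a b : SV) : bracketFun l a b .Y =
    C ((a .L).eval (-l)) * (b .Y).comp (X + C l) * (X + C (3 / 2 * l))
    + C ((a .Y).eval (-l)) * (b .L).comp (X + C l) * (C (1 / 2) * X + C (3 / 2 * l)) := by
  simp [bracketFun, sum_gen, coeff]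

/-- The `λ`-bracket as a bilinear map. -/
def bracket (l : ℂ) : SV →ₗ[ℂ] SV →ₗ[ℂ] SV :=
  LinearMap.mk₂ ℂ (bracketFun l)
    (by intro a a' b; ext1 z; cases z <;> simp [bracketFun_L, bracketFun_M, bracketFun_Y] <;> ring)
    (by intro c a b; ext1 z; cases z <;>
          simp [bracketFun_L, bracketFun_M, bracketFun_Y, smul_eq_C_mul] <;> ring)
    (by intro a b b'; ext1 z; cases z <;> simp [bracketFun_L, bracketFun_M, bracketFun_Y] <;> ring)
    (by intro c a b; ext1 z; cases z <;>
          simp [bracketFun_L, bracketFun_M, bracketFun_Y, smul_eq_C_mul] <;> ring)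

/-- Multiplication by `∂`. -/
def D : SV →ₗ[ℂ] SV where
  toFun a := fun x => X * a x
  map_add' a b := by ext1 x; simp [mul_add]
  map_smul' c a := by ext1 x; simp

theorem D_apply (a : SV) (x : SVGen) : D a x = X * a x := rfl

/-- The bracket with `λ` a second variable (the outer one). -/
def bracketPoly (a b : SV) : SVGen → ℂ[X][X]
  | .L => (((a .L).map C).comp (-X)) * ((b .L).map C).comp (C X + X) * (C X + 2 * X)
  | .M => (((a .L).map C).comp (-X)) * ((b .M).map C).comp (C X + X) * (C X + X)
    + (((a .M).map C).comp (-X)) * ((b .L).map C).comp (C X + X) * X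
    + (((a .Y).map C).comp (-X)) * ((b .Y).map C).comp (C X + X) * (C X + 2 * X)
  | .Y => (((a .L).map C).comp (-X)) * ((b .Y).map C).comp (C X + X) * (C X + C (C (3 / 2)) * X)
    + (((a .Y).map C).comp (-X)) * ((b .L).map C).comp (C X + X)
      * (C (C (1 / 2)) * C X + C (C (3 / 2)) * X)

theorem eval_map_C (p : ℂ[X]) (q : ℂ[X]) : (p.map C).eval q = p.comp q := by
  rw [eval_map]; rfl

theorem comp_C' (p : ℂ[X]) (l : ℂ) : p.comp (-C l) = C (p.eval (-l)) := by
  rw [← C_neg, comp_C]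

theorem bracketPoly_eval (a b : SV) (m : ℂ) (z : SVGen) :
    (bracketPoly a b z).eval (C m) = bracketFun m a b z := by
  cases z <;>
    simp [bracketPoly, bracketFun_L, bracketFun_M, bracketFun_Y, eval_comp, eval_map_C, comp_C',
      show (C (2 : ℂ) : ℂ[X]) = 2 from rfl]

theorem bracketPoly_eval' (a b : SV) (l : ℂ) (z : SVGen) :
    (bracketPoly b a z).eval (-C l - X) = - bracketFun l a b z := by
  have h1 : ∀ p : ℂ[X], p.comp (X + (-C l - X)) = C (p.eval (-l)) := fun p => by
    rw [show (X + (-C l - X) : ℂ[X]) = -C l by ring, comp_C']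
  have h2 : ∀ p : ℂ[X], p.comp (-(-C l - X)) = p.comp (X + C l) := fun p => by
    rw [show (-(-C l - X) : ℂ[X]) = X + C l by ring]
  have h3 : (C (1 / 2) : ℂ[X]) = C (3 / 2) - 1 := by
    rw [← C_1, ← C_sub]; norm_num
  cases z <;>
    simp only [bracketPoly, bracketFun_L, bracketFun_M, bracketFun_Y, eval_comp, eval_map_C,
      eval_mul, eval_add, eval_X, eval_C, eval_neg, eval_ofNat, C_mul, h1, h2, h3,
      show (C (2 : ℂ) : ℂ[X]) = 2 from rfl] <;>
    ring

theorem D_pow (l : ℂ) (j : ℕ) (c : SV) (z : SVGen) :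
    (((-(l • LinearMap.id) - D : Module.End ℂ SV) ^ j) c) z = (-C l - X) ^ j * c z := by
  induction j with
  | zero => simp
  | succ j ih =>
    rw [pow_succ', Module.End.mul_apply]
    simp only [LinearMap.sub_apply, LinearMap.neg_apply, LinearMap.smul_apply, LinearMap.id_apply,
      Pi.sub_apply, Pi.neg_apply, Pi.smul_apply, D_apply, ih, smul_eq_C_mul]
    ring

/-- The Schrödinger-Virasoro conformal algebra. -/
def conformalAlgebra : LieConformalAlgebra SV where
  D := D
  bracket := bracket
  bracket_D_left l a b := by
    ext1 z
    cases z <;> simp [bracket, D, bracketFun_L, bracketFun_M, bracketFun_Y, smul_eq_C_mul] <;> ring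
  bracket_D_right l a b := by
    ext1 z
    cases z <;> simp [bracket, D, bracketFun_L, bracketFun_M, bracketFun_Y, smul_eq_C_mul] <;> ring
  skew a b := by
    refine ⟨∑ z, ((bracketPoly b a z).natDegree + 1), fun j z => (bracketPoly b a z).coeff j,
      fun m => ?_, fun l => ?_⟩
    · ext1 z
      have hz : (bracketPoly b a z).natDegree < ∑ z, ((bracketPoly b a z).natDegree + 1) :=
        Nat.lt_of_succ_le (Finset.single_le_sum (f := fun z => (bracketPoly b a z).natDegree + 1)
          (fun _ _ => Nat.zero_le _) (Finset.mem_univ z))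
      simp only [bracket, LinearMap.mk₂_apply, Finset.sum_apply, Pi.smul_apply]
      rw [← bracketPoly_eval, eval_eq_sum_range' hz]
      exact Finset.sum_congr rfl fun j _ => by rw [smul_eq_C_mul, C_pow, mul_comm]
    · ext1 z
      have hz : (bracketPoly b a z).natDegree < ∑ z, ((bracketPoly b a z).natDegree + 1) :=
        Nat.lt_of_succ_le (Finset.single_le_sum (f := fun z => (bracketPoly b a z).natDegree + 1)
          (fun _ _ => Nat.zero_le _) (Finset.mem_univ z))
      simp only [bracket, LinearMap.mk₂_apply, Finset.sum_apply, Pi.neg_apply, D_pow]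
      rw [eq_neg_iff_add_eq_zero, ← neg_neg (bracketFun l a b z), ← bracketPoly_eval',
        eval_eq_sum_range' hz, neg_add_eq_zero]
      exact Finset.sum_congr rfl fun j _ => mul_comm _ _
  jacobi l m a b c := by
    have e1 : ∀ r : ℂ, r + m + l = r + l + m := fun r => by ring
    have e2 : ∀ r : ℂ, r + (l + m) = r + l + m := fun r => by ring
    have e3 : -(l + m) + l = -m := by ring
    ext1 z
    refine Polynomial.funext fun r => ?_
    cases z <;>
      simp only [bracket, LinearMap.mk₂_apply, Pi.add_apply, bracketFun_L, bracketFun_M,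
        bracketFun_Y, eval_add, eval_mul, eval_comp, eval_X, eval_C, e1, e2, e3] <;>
      ring

/-- The module `V(α, Δ) = ℂ[∂] v` with `L_λ v = (∂ + α + Δλ) v` and `M_λ v = Y_λ v = 0`. The vector
`p(∂) v` is `p`, and `(q(∂) L)_λ p(∂) v = q(-λ) p(∂ + λ) (∂ + α + Δλ) v`. -/
def rankOne (α Δ : ℂ) : ConformalModule conformalAlgebra ℂ[X] where
  D := LinearMap.mulLeft ℂ X
  act l := LinearMap.mk₂ ℂ
    (fun a p => C ((a .L).eval (-l)) * p.comp (X + C l) * (X + C α + C (Δ * l)))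
    (by intros; simp; ring) (by intros; simp [smul_eq_C_mul]; ring)
    (by intros; simp; ring) (by intros; simp [smul_eq_C_mul]; ring)
  act_poly a p := by
    obtain ⟨Q, hQ⟩ : ∃ Q : ℂ[X][X], Q = ((a .L).map C).comp (-X) * (p.map C).comp (C X + X) *
      (C X + C (C α) + C (C Δ) * X) := ⟨_, rfl⟩
    refine ⟨Q.natDegree + 1, Q.coeff, fun l => ?_⟩
    have h := eval_eq_sum_range (p := Q) (C l)
    simp only [LinearMap.mk₂_apply, smul_eq_C_mul, C_pow, mul_comm (C l ^ _)]
    rw [← h, hQ]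
    simp [eval_comp, eval_map_C, comp_C']
  act_comm l m a b p := by
    have e1 : ∀ r : ℂ, r + m + l = r + l + m := fun r => by ring
    have e2 : ∀ r : ℂ, r + (l + m) = r + l + m := fun r => by ring
    have e3 : -(l + m) + l = -m := by ring
    refine Polynomial.funext fun r => ?_
    simp only [conformalAlgebra, bracket, LinearMap.mk₂_apply, bracketFun_L, eval_sub, eval_add,
      eval_mul, eval_comp, eval_X, eval_C, e1, e2, e3]
    ring
  act_D l a p := by simp [conformalAlgebra, D_apply, smul_eq_C_mul]; ring
  D_act l a p := by simp [smul_eq_C_mul]; ring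

/-- `S` is the extension of `V(α, Δ)` by `V(α', Δ')` on `ℂ[∂] v' ⊕ ℂ[∂] v` given by
`L_λ v = (∂ + α + Δλ) v + f(∂, λ) v'`, `M_λ v = g(∂, λ) v'`, `Y_λ v = h(∂, λ) v'`. Here
`(q, p)` is `q(∂) v' + p(∂) v`, and `f, g, h ∈ ℂ[∂][λ]`: the outer variable is `λ`. -/
def IsGivenBy {α Δ α' Δ' : ℂ}
    (S : ConformalExtension (rankOne α' Δ') (rankOne α Δ) (ℂ[X] × ℂ[X]))
    (f g h : ℂ[X][X]) : Prop :=
  S.i = LinearMap.inl ℂ ℂ[X] ℂ[X] ∧ S.p = LinearMap.snd ℂ ℂ[X] ℂ[X] ∧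
  (∀ q p, S.toModule.D (q, p) = (X * q, X * p)) ∧
  (∀ l : ℂ, S.toModule.act l (gen .L) (0, 1) = (f.eval (C l), X + C α + C (Δ * l))) ∧
  (∀ l : ℂ, S.toModule.act l (gen .M) (0, 1) = (g.eval (C l), 0)) ∧
  (∀ l : ℂ, S.toModule.act l (gen .Y) (0, 1) = (h.eval (C l), 0))

/-- The variable `λ` of `ℂ[∂][λ]`. -/
def lam : ℂ[X][X] := X

/-- The polynomial `∂ + α` in `ℂ[∂][λ]`. -/
def dbar (α : ℂ) : ℂ[X][X] := C (X + C α)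

/-- The constant `c` in `ℂ[∂][λ]`. -/
def const (c : ℂ) : ℂ[X][X] := C (C c)

/-- The list of pairs `(Δ, Δ')` and polynomials `f` of the nontrivial extensions of Virasoro
conformal modules, with nonzero scalar factors `c`. -/
inductive VirasoroList (α : ℂ) : (Δ Δ' : ℂ) → (f : ℂ[X][X]) → Prop
  | zero (Δ Δ' c₀ c₁ : ℂ) (hc : (c₀, c₁) ≠ (0, 0)) (hΔ : Δ = Δ') :
      VirasoroList α Δ Δ' (const c₀ + const c₁ * lam)
  | two (Δ Δ' c : ℂ) (hc : c ≠ 0) (hΔ : Δ - Δ' = 2) :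
      VirasoroList α Δ Δ' (const c * (lam ^ 2 * (2 * dbar α + lam)))
  | three (Δ Δ' c : ℂ) (hc : c ≠ 0) (hΔ : Δ - Δ' = 3) :
      VirasoroList α Δ Δ' (const c * (dbar α * lam ^ 2 * (dbar α + lam)))
  | four (Δ Δ' c : ℂ) (hc : c ≠ 0) (hΔ : Δ - Δ' = 4) :
      VirasoroList α Δ Δ' (const c * (lam ^ 2 *
        (4 * dbar α ^ 3 + 6 * dbar α ^ 2 * lam - dbar α * lam ^ 2 + const Δ' * lam ^ 3)))
  | five (Δ Δ' c : ℂ) (hc : c ≠ 0) (hΔ : Δ = 1) (hΔ' : Δ' = -4) :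
      VirasoroList α Δ Δ' (const c * (dbar α ^ 4 * lam ^ 2 - 10 * dbar α ^ 2 * lam ^ 4
        - 17 * dbar α * lam ^ 5 - 8 * lam ^ 6))
  | six (Δ Δ' c s : ℂ) (hc : c ≠ 0) (hs : s = (√19 : ℝ) ∨ s = -(√19 : ℝ))
      (hΔ : Δ = 7 / 2 + s / 2) (hΔ' : Δ' = -5 / 2 + s / 2) :
      VirasoroList α Δ Δ' (const c * (dbar α ^ 4 * lam ^ 3
        - const (2 * Δ' + 3) * dbar α ^ 3 * lam ^ 4 - const (3 * Δ') * dbar α ^ 2 * lam ^ 5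
        - const (3 * Δ' + 1) * dbar α * lam ^ 6 - const (Δ' + 9 / 28) * lam ^ 7))

/-- The list of pairs `(Δ, Δ')` and triples `(f, g, h)` for the Schrödinger-Virasoro conformal
algebra. -/
inductive ExtensionList (α : ℂ) : (Δ Δ' : ℂ) → (f g h : ℂ[X][X]) → Prop
  | virasoro (Δ Δ' : ℂ) (f : ℂ[X][X]) (hf : VirasoroList α Δ Δ' f) :
      ExtensionList α Δ Δ' f 0 0
  | neg_half (Δ Δ' a : ℂ) (ha : a ≠ 0) (hΔ : Δ - Δ' = -1 / 2) :
      ExtensionList α Δ Δ' 0 0 (const a)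
  | half (Δ Δ' a : ℂ) (ha : a ≠ 0) (hΔ : Δ - Δ' = 1 / 2) :
      ExtensionList α Δ Δ' 0 0 (const a * (dbar α + const (2 * Δ') * lam))
  | three_halves (Δ Δ' a : ℂ) (ha : a ≠ 0) (hΔ : Δ = 1) (hΔ' : Δ' = -1 / 2) :
      ExtensionList α Δ Δ' 0 0 (const a * (dbar α ^ 2 - lam ^ 2))

end SV

end

/-! The quotient is free of rank one over ℂ[∂], so any lift v of its generator splits an extension
as ℂ[∂]v' ⊕ ℂ[∂]v, and the action is recorded by three polynomials f, g, h. Since M and Y kill v',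
the module axioms become separate conditions: [L, L] makes f a cocycle (`IsCocycle`), [L, Y] gives
the linear condition `IsYCocycle` on h, and [Y, Y] gives (λ - μ) g(∂, λ + μ) = 0, hence g = 0.
Replacing v by v + φ(∂)v' adds a coboundary to f and does not change h. What has to be found is
therefore the cocycles f modulo coboundaries, and all solutions h.

If α ≠ α', putting λ = 0 shows that f is a coboundary and h = 0. If α = α', a translation in ∂
reduces to α = 0, and coefficients of monomials in ∂, λ, μ can be compared. Write k = Δ - Δ'.

For f, coboundaries remove the terms linear in λ, and the terms free of λ vanish; the only
exceptions are the constant and the multiple of λ when k = 0. The rest is homogeneous of degree k +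
1 and determined by its coefficients of λ² and λ³ (`IsCocycle.eq_zero`). In this space of dimension
at most two lies the coboundary of ∂^k. For k = 2, 3, 4 the list supplies the second dimension. For
k ≥ 5 the coefficient of λ³μ⁴ shows that a certain quadratic in Δ' must vanish if a cocycle is
independent of that coboundary; this leaves Δ' = -4 for k = 5 and 2Δ'² + 10Δ' + 3 = 0 for k = 6. For
k ≥ 7 the coefficient of λ⁴μ⁵ excludes every Δ'.

For h, every solution is homogeneous of degree k + 1/2 and determined by its pure power of ∂; the
remaining relations force degree at most two, and Δ' = -1/2 in degree two. As k is an integer when f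
contributes and a half-integer when h does, the two never occur together. -/

namespace SV

/-! ### Coefficients of polynomials in two and three variables -/

/-- The coefficient of `∂ ^ i * λ ^ j`. -/
noncomputable def bicoeff (f : ℂ[X][X]) (i j : ℕ) : ℂ := (f.coeff j).coeff i

theorem eq_of_forall_eval_eq {R : Type*} [CommRing R] [IsDomain R] (ι : ℂ → R)
    (hι : Function.Injective ι) {F G : R[X]} (h : ∀ m, F.eval (ι m) = G.eval (ι m)) : F = G :=
  eq_of_infinite_eval_eq F G ((Set.infinite_range_of_injective hι).mono (by
    rintro _ ⟨m, rfl⟩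
    exact h m))

theorem eq_of_forall_evalEval_eq {f g : ℂ[X][X]}
    (h : ∀ x l : ℂ, f.evalEval x l = g.evalEval x l) : f = g :=
  eq_of_forall_eval_eq C C_injective fun l => Polynomial.funext fun x => h x l

theorem eq_of_forall_evalEval_eval_eq {F G : ℂ[X][X][X]}
    (h : ∀ x l m : ℂ, (F.eval (C (C m))).evalEval x l = (G.eval (C (C m))).evalEval x l) :
    F = G :=
  eq_of_forall_eval_eq (fun m => C (C m)) (C_injective.comp C_injective) fun m =>
    eq_of_forall_evalEval_eq fun x l => h x l m

theorem coeff_coeff_swap {R : Type*} [CommRing R] (p : R[X][X]) (i j : ℕ) :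
    ((Bivariate.swap p).coeff i).coeff j = (p.coeff j).coeff i := by
  induction p using Polynomial.induction_on' with
  | add p q hp hq => simp [hp, hq]
  | monomial n f =>
    induction f using Polynomial.induction_on' with
    | add p q hp hq => simp only [map_add, coeff_add, hp, hq]
    | monomial k r =>
      rw [Bivariate.swap_monomial_monomial]
      simp only [coeff_monomial]
      split_ifs <;> simp_all [coeff_monomial]

theorem hasseDeriv_map {R S : Type*} [Semiring R] [Semiring S] (φ : R →+* S) (k : ℕ) (p : R[X]) :
    hasseDeriv k (p.map φ) = (hasseDeriv k p).map φ := by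
  ext n
  simp [hasseDeriv_coeff]

/-- The homomorphism `g(∂) ↦ g(∂ + λ)`. -/
noncomputable def addVar : ℂ[X] →+* ℂ[X][X] := eval₂RingHom (C.comp C) (X + C X)

theorem addVar_apply (g : ℂ[X]) : addVar g = taylor X (g.map C) := by
  rw [taylor_apply, comp, eval₂_map]
  rfl

theorem addVar_C (c : ℂ) : addVar (C c) = C (C c) := by simp [addVar]

theorem evalEval_addVar (g : ℂ[X]) (x l : ℂ) : (addVar g).evalEval x l = g.eval (x + l) := by
  rw [addVar_apply, taylor_apply, evalEval, eval_comp, eval_map_C, eval_comp]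
  simp [add_comm]

theorem bicoeff_addVar (g : ℂ[X]) (a b : ℕ) :
    bicoeff (addVar g) a b = (a + b).choose b * g.coeff (a + b) := by
  rw [bicoeff, addVar_apply, taylor_coeff, ← hasseDeriv_coeff]
  congr 1
  rw [hasseDeriv_map, eval_map_C, comp_X]

/-- The coefficient of `∂ ^ a * λ ^ b * μ ^ c`. -/
noncomputable def tricoeff (F : ℂ[X][X][X]) (a b c : ℕ) : ℂ := bicoeff (F.coeff c) a b

/-- In ℂ[∂][λ][μ], the polynomial `C f` is f(∂, λ), `f.map C` is f(∂, μ), `f.map addVar` is f(∂ + λ,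
μ), and `taylor X (f.map C)` is f(∂, λ + μ). Both shifts produce binomial coefficients. -/
theorem tricoeff_map_addVar (f : ℂ[X][X]) (a b c : ℕ) :
    tricoeff (f.map addVar) a b c = (a + b).choose b * bicoeff f (a + b) c := by
  rw [tricoeff, coeff_map, bicoeff_addVar, bicoeff]

theorem tricoeff_taylor (f : ℂ[X][X]) (a b c : ℕ) :
    tricoeff (taylor X (f.map C)) a b c = (b + c).choose c * bicoeff f a (b + c) := by
  rw [tricoeff, bicoeff, bicoeff, taylor_coeff]
  have h : (hasseDeriv c (f.map C)).eval (X : ℂ[X][X]) = hasseDeriv c f := by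
    rw [hasseDeriv_map, eval_map]
    exact comp_X
  rw [h, hasseDeriv_coeff, ← C_eq_natCast, coeff_C_mul]

theorem tricoeff_add (F G : ℂ[X][X][X]) (a b c : ℕ) :
    tricoeff (F + G) a b c = tricoeff F a b c + tricoeff G a b c := by
  simp [tricoeff, bicoeff]

theorem tricoeff_C_C_C_mul (r : ℂ) (F : ℂ[X][X][X]) (a b c : ℕ) :
    tricoeff (C (C (C r)) * F) a b c = r * tricoeff F a b c := by
  simp [tricoeff, bicoeff]

theorem tricoeff_C_C_X_mul_zero (F : ℂ[X][X][X]) (b c : ℕ) :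
    tricoeff (C (C X) * F) 0 b c = 0 := by
  simp [tricoeff, bicoeff]

theorem tricoeff_C_C_X_mul_succ (F : ℂ[X][X][X]) (a b c : ℕ) :
    tricoeff (C (C X) * F) (a + 1) b c = tricoeff F a b c := by
  simp [tricoeff, bicoeff]

theorem tricoeff_C_X_mul_zero (F : ℂ[X][X][X]) (a c : ℕ) :
    tricoeff (C X * F) a 0 c = 0 := by
  simp [tricoeff, bicoeff]

theorem tricoeff_C_X_mul_succ (F : ℂ[X][X][X]) (a b c : ℕ) :
    tricoeff (C X * F) a (b + 1) c = tricoeff F a b c := by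
  simp [tricoeff, bicoeff]

theorem tricoeff_X_mul_zero (F : ℂ[X][X][X]) (a b : ℕ) :
    tricoeff (X * F) a b 0 = 0 := by
  simp [tricoeff, bicoeff]

theorem tricoeff_X_mul_succ (F : ℂ[X][X][X]) (a b c : ℕ) :
    tricoeff (X * F) a b (c + 1) = tricoeff F a b c := by
  simp [tricoeff, bicoeff]

theorem tricoeff_C_zero (f : ℂ[X][X]) (a b : ℕ) : tricoeff (C f) a b 0 = bicoeff f a b := by
  simp [tricoeff, bicoeff]

theorem tricoeff_C_succ (f : ℂ[X][X]) (a b c : ℕ) : tricoeff (C f) a b (c + 1) = 0 := by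
  simp [tricoeff, bicoeff]

theorem tricoeff_map_C_zero (f : ℂ[X][X]) (a c : ℕ) :
    tricoeff (f.map C) a 0 c = bicoeff f a c := by
  simp [tricoeff, bicoeff]

theorem tricoeff_map_C_succ (f : ℂ[X][X]) (a b c : ℕ) : tricoeff (f.map C) a (b + 1) c = 0 := by
  simp [tricoeff, bicoeff]

theorem tricoeff_swap (F : ℂ[X][X][X]) (a b c : ℕ) :
    tricoeff (Bivariate.swap F) a b c = tricoeff F a c b := by
  rw [tricoeff, bicoeff, coeff_coeff_swap, tricoeff, bicoeff]

/-- The value at `∂ = x`, `λ = l`, `μ = m`. -/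
noncomputable def evalThree (x l m : ℂ) : ℂ[X][X][X] →+* ℂ :=
  ((evalRingHom x).comp (evalRingHom (C l))).comp (evalRingHom (C (C m)))

theorem evalThree_apply (x l m : ℂ) (F : ℂ[X][X][X]) :
    evalThree x l m F = (F.eval (C (C m))).evalEval x l := rfl

theorem evalThree_C (x l m : ℂ) (f : ℂ[X][X]) : evalThree x l m (C f) = f.evalEval x l := by
  simp [evalThree_apply]

theorem evalThree_X (x l m : ℂ) : evalThree x l m X = m := by
  simp [evalThree_apply]

theorem evalThree_map_C (x l m : ℂ) (f : ℂ[X][X]) :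
    evalThree x l m (f.map C) = f.evalEval x m := by
  rw [evalThree_apply, eval_map, eval₂_at_apply, evalEval, eval_C, evalEval]

theorem evalThree_map_addVar (x l m : ℂ) (f : ℂ[X][X]) :
    evalThree x l m (f.map addVar) = f.evalEval (x + l) m := by
  rw [evalThree_apply, eval_map, ← addVar_C, eval₂_at_apply, evalEval_addVar, evalEval]

theorem evalThree_taylor (x l m : ℂ) (f : ℂ[X][X]) :
    evalThree x l m (taylor X (f.map C)) = f.evalEval x (l + m) := by
  have h : ((X : ℂ[X][X]) + C (C m)).eval (C l) = C (l + m) := by simp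
  have h' : eval (C (C m)) ((X : ℂ[X][X][X]) + C X) = X + C (C m) := by simp [add_comm]
  rw [evalThree_apply, taylor_apply, eval_comp, h', evalEval, eval_map, evalEval]
  change (eval (C l) (f.comp _)).eval x = _
  rw [eval_comp, h]

theorem evalThree_swap (x l m : ℂ) (F : ℂ[X][X][X]) :
    evalThree x l m (Bivariate.swap F) = evalThree x m l F := by
  induction F using Polynomial.induction_on' with
  | add p q hp hq => simp [hp, hq]
  | monomial n f =>
    induction f using Polynomial.induction_on' with
    | add p q hp hq => simp only [map_add, hp, hq]
    | monomial k r =>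
      rw [Bivariate.swap_monomial_monomial]
      simp only [← C_mul_X_pow_eq_monomial, map_mul, map_pow, evalThree_C, evalThree_X,
        evalEval_C, evalEval_X]
      ring

theorem eq_of_forall_evalThree_eq {F G : ℂ[X][X][X]}
    (h : ∀ x l m : ℂ, evalThree x l m F = evalThree x l m G) : F = G :=
  eq_of_forall_evalEval_eval_eq h

/-! ### Cocycles -/

/-- The condition on `f` for the `λ`-action of `L` with `L_λ v = (∂ + α + Δλ) v + f(∂, λ) v'`. -/
def IsCocycle (α α' Δ Δ' : ℂ) (f : ℂ[X][X]) : Prop := ∀ x l m : ℂ,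
  (x + l + α + Δ * m) * f.evalEval x l + (x + α' + Δ' * l) * f.evalEval (x + l) m
    - ((x + m + α + Δ * l) * f.evalEval x m + (x + α' + Δ' * m) * f.evalEval (x + m) l)
    = (l - m) * f.evalEval x (l + m)

/-- The condition on `h` for the `λ`-action of `L` and `Y` with `Y_λ v = h(∂, λ) v'`. -/
def IsYCocycle (α α' Δ Δ' : ℂ) (h : ℂ[X][X]) : Prop := ∀ x l m : ℂ,
  (x + α' + Δ' * l) * h.evalEval (x + l) m - (x + m + α + Δ * l) * h.evalEval x m
    = (l / 2 - m) * h.evalEval x (l + m)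

/-- The polynomial `(∂ + α' + Δ'λ) φ(∂ + λ) - (∂ + α + Δλ) φ(∂)`. -/
noncomputable def coboundary (α α' Δ Δ' : ℂ) (φ : ℂ[X]) : ℂ[X][X] :=
  (C X + C (C α') + C (C Δ') * X) * addVar φ - (C X + C (C α) + C (C Δ) * X) * C φ

theorem evalEval_coboundary (α α' Δ Δ' : ℂ) (φ : ℂ[X]) (x l : ℂ) :
    (coboundary α α' Δ Δ' φ).evalEval x l =
      (x + α' + Δ' * l) * φ.eval (x + l) - (x + α + Δ * l) * φ.eval x := by
  simp only [coboundary, evalEval_sub, evalEval_mul, evalEval_add, evalEval_C, evalEval_X,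
    evalEval_addVar, eval_X, eval_C]

theorem eval_C_coboundary (α α' Δ Δ' : ℂ) (φ : ℂ[X]) (l : ℂ) :
    (coboundary α α' Δ Δ' φ).eval (C l) =
      (X + C α' + C (Δ' * l)) * φ.comp (X + C l) - (X + C α + C (Δ * l)) * φ := by
  refine Polynomial.funext fun x => ?_
  change (coboundary α α' Δ Δ' φ).evalEval x l = _
  rw [evalEval_coboundary]
  simp

theorem coboundary_add (α α' Δ Δ' : ℂ) (φ χ : ℂ[X]) :
    coboundary α α' Δ Δ' (φ + χ) = coboundary α α' Δ Δ' φ + coboundary α α' Δ Δ' χ := by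
  simp only [coboundary, map_add]
  ring

theorem isCocycle_coboundary (α α' Δ Δ' : ℂ) (φ : ℂ[X]) :
    IsCocycle α α' Δ Δ' (coboundary α α' Δ Δ' φ) := by
  intro x l m
  simp only [evalEval_coboundary]
  rw [show x + m + l = x + l + m by ring, show x + (l + m) = x + l + m by ring]
  ring

theorem IsCocycle.sub {α α' Δ Δ' : ℂ} {f g : ℂ[X][X]} (hf : IsCocycle α α' Δ Δ' f)
    (hg : IsCocycle α α' Δ Δ' g) : IsCocycle α α' Δ Δ' (f - g) := by
  intro x l m
  simp only [evalEval_sub]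
  linear_combination hf x l m - hg x l m

/-- If `α ≠ α'`, then every cocycle is a coboundary. -/
theorem IsCocycle.exists_eq_coboundary_of_ne {α α' Δ Δ' : ℂ} (h : α ≠ α') {f : ℂ[X][X]}
    (hf : IsCocycle α α' Δ Δ' f) : ∃ φ, f = coboundary α α' Δ Δ' φ := by
  -- At λ = 0 the cocycle identity says that (α' - α) f is the coboundary of f(∂, 0).
  refine ⟨C (α' - α)⁻¹ * f.eval (C 0), eq_of_forall_evalEval_eq fun x m => ?_⟩
  have h0 : α' - α ≠ 0 := sub_ne_zero.2 h.symm
  have e := hf x 0 m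
  simp only [evalEval_coboundary, eval_mul, eval_C]
  simp only [evalEval, zero_add, add_zero] at e ⊢
  field_simp
  linear_combination e

/-- At λ = 0 the identity collapses to (α' - α) f = 0. -/
theorem IsYCocycle.eq_zero_of_ne {α α' Δ Δ' : ℂ} (h : α ≠ α') {f : ℂ[X][X]}
    (hf : IsYCocycle α α' Δ Δ' f) : f = 0 := by
  refine eq_of_forall_evalEval_eq fun x m => ?_
  have h0 : α' - α ≠ 0 := sub_ne_zero.2 h.symm
  have e := hf x 0 m
  simp only [zero_add, add_zero] at e
  rw [evalEval_zero]
  exact (mul_eq_zero.1 (by linear_combination e : (α' - α) * f.evalEval x m = 0)).resolve_left h0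

/-! ### Relations between the coefficients of a cocycle -/

theorem tricoeff_mul_map_addVar (Δ' : ℂ) (f : ℂ[X][X]) (a b c : ℕ) :
    tricoeff ((C (C X) + C (C (C Δ')) * C X) * f.map addVar) a (b + 1) c
      = ((a + b).choose (b + 1) + Δ' * (a + b).choose b) * bicoeff f (a + b) c := by
  rw [add_mul, tricoeff_add, mul_assoc, tricoeff_C_C_C_mul, tricoeff_C_X_mul_succ,
    tricoeff_map_addVar]
  cases a with
  | zero => rw [tricoeff_C_C_X_mul_zero]; simp
  | succ a =>
    rw [tricoeff_C_C_X_mul_succ, tricoeff_map_addVar, show a + 1 + b = a + (b + 1) by ring]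
    ring

/-- The polynomial of which the antisymmetrization in `λ, μ` appears in `IsCocycle`. -/
noncomputable def cocycleHalf (Δ Δ' : ℂ) (f : ℂ[X][X]) : ℂ[X][X][X] :=
  (C (C X) + C X + C (C (C Δ)) * X) * C f + (C (C X) + C (C (C Δ')) * C X) * f.map addVar

theorem IsCocycle.cocycleHalf_add {Δ Δ' : ℂ} {f : ℂ[X][X]} (hf : IsCocycle 0 0 Δ Δ' f) :
    cocycleHalf Δ Δ' f + X * taylor X (f.map C) =
      Bivariate.swap (cocycleHalf Δ Δ' f) + C X * taylor X (f.map C) := by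
  refine eq_of_forall_evalThree_eq fun x l m => ?_
  have e := hf x l m
  rw [map_add, map_add, evalThree_swap]
  simp only [cocycleHalf, map_add, map_mul, evalThree_C, evalThree_X,
    evalThree_map_addVar, evalThree_taylor, evalEval_C, evalEval_X, eval_X, eval_C]
  linear_combination e

theorem IsCocycle.tricoeff_eq {Δ Δ' : ℂ} {f : ℂ[X][X]} (hf : IsCocycle 0 0 Δ Δ' f)
    (a b c : ℕ) : tricoeff (cocycleHalf Δ Δ' f) a b c + tricoeff (X * taylor X (f.map C)) a b c =
      tricoeff (cocycleHalf Δ Δ' f) a c b + tricoeff (C X * taylor X (f.map C)) a b c := by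
  rw [← tricoeff_add, hf.cocycleHalf_add, tricoeff_add, tricoeff_swap]

theorem tricoeff_cocycleHalf_succ_add_two (Δ Δ' : ℂ) (f : ℂ[X][X]) (a b c : ℕ) :
    tricoeff (cocycleHalf Δ Δ' f) a (b + 1) (c + 2)
      = ((a + b).choose (b + 1) + Δ' * (a + b).choose b) * bicoeff f (a + b) (c + 2) := by
  rw [cocycleHalf, tricoeff_add, tricoeff_mul_map_addVar, add_mul, add_mul, tricoeff_add,
    tricoeff_add, mul_assoc, tricoeff_C_C_C_mul, tricoeff_X_mul_succ, tricoeff_C_succ,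
    tricoeff_C_X_mul_succ, tricoeff_C_succ]
  cases a with
  | zero => rw [tricoeff_C_C_X_mul_zero]; ring
  | succ a => rw [tricoeff_C_C_X_mul_succ, tricoeff_C_succ]; ring

theorem tricoeff_cocycleHalf_succ_one (Δ Δ' : ℂ) (f : ℂ[X][X]) (a b : ℕ) :
    tricoeff (cocycleHalf Δ Δ' f) a (b + 1) 1 = Δ * bicoeff f a (b + 1)
      + ((a + b).choose (b + 1) + Δ' * (a + b).choose b) * bicoeff f (a + b) 1 := by
  rw [cocycleHalf, tricoeff_add, tricoeff_mul_map_addVar, add_mul, add_mul, tricoeff_add,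
    tricoeff_add, mul_assoc, tricoeff_C_C_C_mul, tricoeff_X_mul_succ, tricoeff_C_zero,
    tricoeff_C_X_mul_succ, tricoeff_C_succ]
  cases a with
  | zero => rw [tricoeff_C_C_X_mul_zero]; ring
  | succ a => rw [tricoeff_C_C_X_mul_succ, tricoeff_C_succ]; ring

/-- At ∂ = λ = 0 the cocycle identity reduces to μ(Δ f(0, 0) - Δ' f(μ, 0)) = 0. The positive powers
in f(μ, 0) give this statement, and its constant term gives the next one. -/
theorem IsCocycle.bicoeff_add_one_zero {Δ Δ' : ℂ} (hΔ' : Δ' ≠ 0) {f : ℂ[X][X]}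
    (hf : IsCocycle 0 0 Δ Δ' f) (i : ℕ) : bicoeff f (i + 1) 0 = 0 := by
  have e := hf.tricoeff_eq 0 0 (i + 2)
  rw [cocycleHalf, tricoeff_add, tricoeff_add, tricoeff_mul_map_addVar] at e
  simp only [add_mul, mul_assoc, tricoeff_add, tricoeff_C_C_C_mul,
    tricoeff_X_mul_zero, tricoeff_X_mul_succ, tricoeff_C_X_mul_zero, tricoeff_C_X_mul_succ,
    tricoeff_C_C_X_mul_zero, tricoeff_C_zero, tricoeff_C_succ, tricoeff_taylor] at e
  simp at e
  grind

theorem IsCocycle.bicoeff_zero_zero {Δ Δ' : ℂ} {f : ℂ[X][X]}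
    (hf : IsCocycle 0 0 Δ Δ' f) : (Δ - Δ') * bicoeff f 0 0 = 0 := by
  have e := hf.tricoeff_eq 0 0 (0 + 1)
  rw [cocycleHalf, tricoeff_add, tricoeff_add, tricoeff_mul_map_addVar] at e
  simp only [add_mul, mul_assoc, tricoeff_add, tricoeff_C_C_C_mul,
    tricoeff_X_mul_zero, tricoeff_X_mul_succ, tricoeff_C_X_mul_zero, tricoeff_C_X_mul_succ,
    tricoeff_C_C_X_mul_zero, tricoeff_C_zero, tricoeff_taylor] at e
  simp at e
  linear_combination e

/-- This is the coefficient of ∂^a λ μ^(c+2). Once the linear terms in λ are gone, it says that the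
terms of λ-degree at least two have total degree Δ - Δ' + 1. -/
theorem IsCocycle.bicoeff_add_two {Δ Δ' : ℂ} {f : ℂ[X][X]} (hf : IsCocycle 0 0 Δ Δ' f)
    (a c : ℕ) : (a + c + 1 + Δ' - Δ) * bicoeff f a (c + 2) =
      ((a + c + 1).choose (c + 2) + Δ' * (a + c + 1).choose (c + 1))
        * bicoeff f (a + c + 1) 1 := by
  have e := hf.tricoeff_eq a (0 + 1) (c + 2)
  rw [tricoeff_cocycleHalf_succ_add_two, show c + 2 = c + 1 + 1 by rfl,
    tricoeff_cocycleHalf_succ_one, tricoeff_C_X_mul_succ,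
    tricoeff_X_mul_succ, tricoeff_taylor, tricoeff_taylor,
    show 0 + 1 + (c + 1) = c + 1 + 1 by ring] at e
  simp only [zero_add, add_zero, Nat.choose_self, Nat.choose_zero_right, Nat.choose_one_right,
    Nat.choose_succ_self_right] at e
  push_cast at e
  linear_combination e

/-- The relation given by the coefficients of `∂ ^ a * λ ^ (b + 2) * μ ^ (c + 2)`. -/
theorem IsCocycle.bicoeff_rel {Δ Δ' : ℂ} {f : ℂ[X][X]} (hf : IsCocycle 0 0 Δ Δ' f)
    (a b c : ℕ) :
    ((a + b + 1).choose (b + 2) + Δ' * (a + b + 1).choose (b + 1)) * bicoeff f (a + b + 1) (c + 2)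
    - ((a + c + 1).choose (c + 2) + Δ' * (a + c + 1).choose (c + 1))
      * bicoeff f (a + c + 1) (b + 2) =
      ((b + c + 3).choose (c + 2) - (b + c + 3).choose (c + 1)) * bicoeff f a (b + c + 3) := by
  have e := hf.tricoeff_eq a (b + 1 + 1) (c + 2)
  rw [tricoeff_cocycleHalf_succ_add_two, show c + 2 = c + 1 + 1 by rfl,
    show b + 1 + 1 = b + 2 by rfl,
    tricoeff_cocycleHalf_succ_add_two, show b + 2 = b + 1 + 1 by rfl, tricoeff_C_X_mul_succ,
    tricoeff_X_mul_succ, tricoeff_taylor, tricoeff_taylor,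
    show b + 1 + (c + 1 + 1) = b + c + 3 by ring, show b + 1 + 1 + (c + 1) = b + c + 3 by ring] at e
  linear_combination e

/-! ### Relations between the coefficients for the action of `Y` -/

theorem IsYCocycle.polynomial_eq {Δ Δ' : ℂ} {h : ℂ[X][X]} (hh : IsYCocycle 0 0 Δ Δ' h) :
    (C (C X) + C (C (C Δ')) * C X) * h.map addVar + X * taylor X (h.map C) =
      C (C (C (1 / 2))) * (C X * taylor X (h.map C))
        + (C (C X) * h.map C + X * h.map C + C (C (C Δ)) * (C X * h.map C)) := by
  refine eq_of_forall_evalThree_eq fun x l m => ?_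
  have e := hh x l m
  simp only [map_add, map_mul, evalThree_C, evalThree_X, evalThree_map_C,
    evalThree_map_addVar, evalThree_taylor, evalEval_C, evalEval_X, eval_X, eval_C]
  linear_combination e

/-- This is the coefficient of ∂^a λ^(b+1) μ^c. The positive power of λ discards (∂ + μ) h(∂, μ). -/
theorem IsYCocycle.tricoeff_eq {Δ Δ' : ℂ} {h : ℂ[X][X]} (hh : IsYCocycle 0 0 Δ Δ' h)
    (a b c : ℕ) : ((a + b).choose (b + 1) + Δ' * (a + b).choose b) * bicoeff h (a + b) c
      - Δ * tricoeff (h.map C) a b c =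
      1 / 2 * ((b + c).choose c * bicoeff h a (b + c))
        - tricoeff (X * taylor X (h.map C)) a (b + 1) c := by
  have e := congrArg (tricoeff · a (b + 1) c) hh.polynomial_eq
  simp only [tricoeff_add, tricoeff_mul_map_addVar,
    tricoeff_C_C_C_mul, tricoeff_C_X_mul_succ, tricoeff_taylor] at e
  have h1 : tricoeff (C (C X) * h.map C) a (b + 1) c = 0 := by
    cases a with
    | zero => rw [tricoeff_C_C_X_mul_zero]
    | succ a => rw [tricoeff_C_C_X_mul_succ, tricoeff_map_C_succ]
  have h2 : tricoeff (X * h.map C) a (b + 1) c = 0 := by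
    cases c with
    | zero => rw [tricoeff_X_mul_zero]
    | succ c => rw [tricoeff_X_mul_succ, tricoeff_map_C_succ]
  linear_combination e + h1 + h2

/-- The terms linear in λ express homogeneity of h, of degree Δ - Δ' + 1/2. -/
theorem IsYCocycle.bicoeff_eq_zero_or {Δ Δ' : ℂ} {h : ℂ[X][X]} (hh : IsYCocycle 0 0 Δ Δ' h)
    (a c : ℕ) : bicoeff h a c = 0 ∨ Δ - Δ' = a + c - 1 / 2 := by
  have e := hh.tricoeff_eq a 0 c
  have e' : (a + c + Δ' - Δ - 1 / 2) * bicoeff h a c = 0 := by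
    cases c with
    | zero =>
      rw [tricoeff_X_mul_zero, tricoeff_map_C_zero] at e
      simp at e
      push_cast
      linear_combination e
    | succ c =>
      rw [tricoeff_X_mul_succ, tricoeff_map_C_zero, tricoeff_taylor] at e
      simp [add_comm 1 c] at e
      push_cast
      linear_combination e
  rcases mul_eq_zero.1 e' with h0 | h0
  · right
    linear_combination -h0
  · exact Or.inl h0

/-- The terms free of μ determine h from h(∂, 0). The next two lemmas, from the terms linear in μ,
are the compatibility conditions on h(∂, 0). -/
theorem IsYCocycle.bicoeff_succ {Δ Δ' : ℂ} {h : ℂ[X][X]} (hh : IsYCocycle 0 0 Δ Δ' h)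
    (a b : ℕ) : bicoeff h a (b + 1) =
      2 * ((a + b + 1).choose (b + 2) + Δ' * (a + b + 1).choose (b + 1))
        * bicoeff h (a + b + 1) 0 := by
  have e := hh.tricoeff_eq a (b + 1) 0
  rw [tricoeff_X_mul_zero, tricoeff_map_C_succ, Nat.choose_zero_right, ← add_assoc] at e
  push_cast at e
  linear_combination -2 * e

theorem IsYCocycle.bicoeff_zero_add_two {Δ Δ' : ℂ} {h : ℂ[X][X]} (hh : IsYCocycle 0 0 Δ Δ' h)
    (b : ℕ) : Δ' * bicoeff h (b + 1) 1 = b / 2 * bicoeff h 0 (b + 2) := by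
  have e := hh.tricoeff_eq 0 (b + 1) 1
  rw [tricoeff_X_mul_succ, tricoeff_map_C_succ, tricoeff_taylor] at e
  simp at e
  linear_combination e

theorem IsYCocycle.bicoeff_one_add_two {Δ Δ' : ℂ} {h : ℂ[X][X]} (hh : IsYCocycle 0 0 Δ Δ' h)
    (b : ℕ) : (1 + Δ' * (b + 2)) * bicoeff h (b + 2) 1 = b / 2 * bicoeff h 1 (b + 2) := by
  have e := hh.tricoeff_eq 1 (b + 1) 1
  rw [tricoeff_X_mul_succ, tricoeff_map_C_succ, tricoeff_taylor,
    show 1 + (b + 1) = b + 1 + 1 by ring] at e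
  simp at e
  linear_combination e

/-! ### Coefficients of monomials and coboundaries -/

theorem bicoeff_sub (f g : ℂ[X][X]) (i j : ℕ) :
    bicoeff (f - g) i j = bicoeff f i j - bicoeff g i j := by
  simp [bicoeff]

theorem ext_bicoeff {f g : ℂ[X][X]} (h : ∀ i j, bicoeff f i j = bicoeff g i j) : f = g := by
  ext j i
  exact h i j

theorem bicoeff_zero (i j : ℕ) : bicoeff 0 i j = 0 := by
  simp [bicoeff]

theorem bicoeff_const_mul (c : ℂ) (g : ℂ[X][X]) (i j : ℕ) :
    bicoeff (const c * g) i j = c * bicoeff g i j := by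
  simp [bicoeff, const]

theorem bicoeff_dbar_pow_mul_lam_pow (p q i j : ℕ) :
    bicoeff (dbar 0 ^ p * lam ^ q) i j = if j = q ∧ i = p then 1 else 0 := by
  rw [bicoeff, dbar, lam, C_0, add_zero, ← C_pow, coeff_C_mul_X_pow]
  split_ifs <;> simp_all [coeff_X_pow]

theorem bicoeff_coboundary_zero (Δ Δ' : ℂ) (φ : ℂ[X]) (a : ℕ) :
    bicoeff (coboundary 0 0 Δ Δ' φ) a 0 = 0 := by
  have h : ∀ a, ((addVar φ).coeff 0).coeff a = φ.coeff a := fun a => by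
    have := bicoeff_addVar φ a 0
    simpa [bicoeff] using this
  cases a <;> simp [coboundary, bicoeff, add_mul, mul_assoc, h]

theorem bicoeff_coboundary_succ (Δ Δ' : ℂ) (φ : ℂ[X]) (a b : ℕ) :
    bicoeff (coboundary 0 0 Δ Δ' φ) a (b + 1) =
      ((a + b).choose (b + 1) + Δ' * (a + b).choose b) * φ.coeff (a + b)
        - if b = 0 then Δ * φ.coeff a else 0 := by
  have h : ∀ a b, ((addVar φ).coeff b).coeff a = (a + b).choose b * φ.coeff (a + b) :=
    bicoeff_addVar φ
  cases a with
  | zero => simp [coboundary, bicoeff, add_mul, mul_assoc, h, coeff_C]; split_ifs <;> simp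
  | succ a =>
    simp [coboundary, bicoeff, add_mul, mul_assoc, h, coeff_C, show a + 1 + b = a + (b + 1) by ring]
    split_ifs <;> simp

theorem bicoeff_coboundary_add_two (Δ Δ' : ℂ) (φ : ℂ[X]) (a b : ℕ) :
    bicoeff (coboundary 0 0 Δ Δ' φ) a (b + 2) =
      ((a + b + 1).choose (b + 2) + Δ' * (a + b + 1).choose (b + 1)) * φ.coeff (a + b + 1) := by
  rw [bicoeff_coboundary_succ, if_neg (by omega), sub_zero]
  rfl

/-- The factor vanishes exactly for a = Δ - Δ'. In other degrees a coboundary can remove the linear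
term; in that degree it can be subtracted without creating one. -/
theorem bicoeff_coboundary_one (Δ Δ' : ℂ) (φ : ℂ[X]) (a : ℕ) :
    bicoeff (coboundary 0 0 Δ Δ' φ) a 1 = (a + Δ' - Δ) * φ.coeff a := by
  have h := bicoeff_coboundary_succ Δ Δ' φ a 0
  simp at h
  rw [h]
  ring

/-! ### The polynomials in the list are cocycles -/

theorem evalEval_lam (x l : ℂ) : lam.evalEval x l = l := by simp [lam]

theorem evalEval_dbar (α x l : ℂ) : (dbar α).evalEval x l = x + α := by
  rw [dbar, evalEval_C, eval_add, eval_X, eval_C]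

theorem evalEval_const (c x l : ℂ) : (const c).evalEval x l = c := by simp [const]

theorem evalEval_ofNat (n : ℕ) [n.AtLeastTwo] (x l : ℂ) :
    (ofNat(n) : ℂ[X][X]).evalEval x l = ofNat(n) := by
  simp [evalEval]

theorem sq_eq_of_eq_sqrt {s : ℂ} (hs : s = (√19 : ℝ) ∨ s = -(√19 : ℝ)) : s ^ 2 = 19 := by
  have h : ((√19 : ℝ) : ℂ) ^ 2 = 19 := by
    rw [← Complex.ofReal_pow, Real.sq_sqrt (by norm_num)]
    norm_num
  rcases hs with rfl | rfl
  · exact h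
  · rw [neg_sq, h]

theorem VirasoroList.isCocycle {α Δ Δ' : ℂ} {f : ℂ[X][X]} (hf : VirasoroList α Δ Δ' f) :
    IsCocycle α α Δ Δ' f := by
  intro x l m
  cases hf with
  | zero c₀ c₁ hc hΔ =>
    subst hΔ
    simp only [evalEval_add, evalEval_mul, evalEval_const, evalEval_lam]
    ring
  | two c hc hΔ =>
    obtain rfl : Δ = Δ' + 2 := by linear_combination hΔ
    simp only [evalEval_add, evalEval_mul, evalEval_pow, evalEval_const, evalEval_lam,
      evalEval_dbar, evalEval_ofNat]
    ring
  | three c hc hΔ =>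
    obtain rfl : Δ = Δ' + 3 := by linear_combination hΔ
    simp only [evalEval_add, evalEval_mul, evalEval_pow, evalEval_const, evalEval_lam,
      evalEval_dbar]
    ring
  | four c hc hΔ =>
    obtain rfl : Δ = Δ' + 4 := by linear_combination hΔ
    simp only [evalEval_add, evalEval_sub, evalEval_mul, evalEval_pow, evalEval_const,
      evalEval_lam, evalEval_dbar, evalEval_ofNat]
    ring
  | five c hc hΔ hΔ' =>
    subst hΔ hΔ'
    simp only [evalEval_sub, evalEval_mul, evalEval_pow, evalEval_const,
      evalEval_lam, evalEval_dbar, evalEval_ofNat]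
    ring
  | six c s hc hs hΔ hΔ' =>
    -- For Δ = Δ' + 6 and arbitrary Δ', the cocycle identity fails by this quadratic times a
    -- polynomial antisymmetric in l and m.
    have hq : 2 * Δ' ^ 2 + 10 * Δ' + 3 = 0 := by
      rw [hΔ']
      linear_combination sq_eq_of_eq_sqrt hs / 2
    obtain rfl : Δ = Δ' + 6 := by rw [hΔ, hΔ']; ring
    simp only [evalEval_sub, evalEval_mul, evalEval_pow, evalEval_const,
      evalEval_lam, evalEval_dbar]
    generalize hy : x + α = y
    rw [show x + l + α = y + l by rw [← hy]; ring, show x + m + α = y + m by rw [← hy]; ring]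
    linear_combination -(c / 2) *
      (m * (2 * y ^ 3 * l ^ 4 + 3 * y ^ 2 * l ^ 5 + 3 * y * l ^ 6 + l ^ 7)
        + l * (2 * (y + l) ^ 3 * m ^ 4 + 3 * (y + l) ^ 2 * m ^ 5 + 3 * (y + l) * m ^ 6 + m ^ 7)
        - l * (2 * y ^ 3 * m ^ 4 + 3 * y ^ 2 * m ^ 5 + 3 * y * m ^ 6 + m ^ 7)
        - m * (2 * (y + m) ^ 3 * l ^ 4 + 3 * (y + m) ^ 2 * l ^ 5 + 3 * (y + m) * l ^ 6 + l ^ 7))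
      * hq

/-! ### Classification of the cocycles -/

/-- Homogeneity kills the coefficients of λ² and λ³ outside the degree selected by Δ - Δ', and the
hypotheses kill the selected ones. The relations at λ²μ^(c+3) then determine the coefficients of
λ^(c+4) from those of λ² and λ^(c+3). -/
theorem IsCocycle.eq_zero {Δ Δ' : ℂ} (hΔ' : Δ' ≠ 0) {f : ℂ[X][X]}
    (hf : IsCocycle 0 0 Δ Δ' f) (h0 : bicoeff f 0 0 = 0) (h1 : ∀ a, bicoeff f a 1 = 0)
    (h2 : ∀ a : ℕ, Δ - Δ' = a + 1 → bicoeff f a 2 = 0)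
    (h3 : ∀ a : ℕ, Δ - Δ' = a + 2 → bicoeff f a 3 = 0) : f = 0 := by
  have aux : ∀ a j : ℕ, Δ - Δ' ≠ a + j + 1 → bicoeff f a (j + 2) = 0 := fun a j h => by
    have e := hf.bicoeff_add_two a j
    rw [h1, mul_zero] at e
    exact (mul_eq_zero.1 e).resolve_left fun h' => h (by linear_combination -h')
  have H2 : ∀ a, bicoeff f a 2 = 0 := fun a => by
    by_cases h : Δ - Δ' = a + 1
    · exact h2 a h
    · exact aux a 0 (by simpa using h)
  have H3 : ∀ a, bicoeff f a 3 = 0 := fun a => by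
    by_cases h : Δ - Δ' = a + 2
    · exact h3 a h
    · exact aux a 1 (by push_cast; rw [add_assoc]; norm_num; exact h)
  have H : ∀ c a, bicoeff f a (c + 3) = 0 := by
    intro c
    induction c with
    | zero => exact H3
    | succ c ih =>
      intro a
      have e := hf.bicoeff_rel a 0 (c + 1)
      rw [show c + 1 + 2 = c + 3 by rfl, ih, show 0 + 2 = 2 by rfl, H2, mul_zero, mul_zero,
        sub_zero, show 0 + (c + 1) + 3 = c + 4 by ring] at e
      -- The difference is -(c + 4)(c + 1)/2. The analogous factor for λ³, at c = -1, is zero, so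
      -- the coefficients of λ³ have to be prescribed.
      have hc : (((c + 4).choose (c + 3) : ℂ) - (c + 4).choose (c + 1 + 1)) ≠ 0 := by
        rw [Nat.choose_succ_self_right, Nat.choose_symm_of_eq_add (b := 2) (by ring),
          Nat.cast_choose_two]
        push_cast
        have h5 : ((c : ℂ) + 4) ≠ 0 := by exact_mod_cast (by omega : c + 4 ≠ 0)
        have h6 : ((c : ℂ) + 1) ≠ 0 := by exact_mod_cast (by omega : c + 1 ≠ 0)
        intro h7
        exact mul_ne_zero h5 h6 (by linear_combination -2 * h7)
      exact (mul_eq_zero.1 e.symm).resolve_left hc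
  refine ext_bicoeff fun i j => ?_
  rw [bicoeff_zero]
  match j with
  | 0 =>
    cases i with
    | zero => exact h0
    | succ i => exact hf.bicoeff_add_one_zero hΔ' i
  | 1 => exact h1 i
  | 2 => exact H2 i
  | j + 3 => exact H j i

/-- Subtracting a coboundary one removes the linear terms in `λ`. -/
theorem IsCocycle.exists_bicoeff_one_eq {Δ Δ' : ℂ} (hΔ' : Δ' ≠ 0) {f : ℂ[X][X]}
    (hf : IsCocycle 0 0 Δ Δ' f) : ∃ φ : ℂ[X], ∀ a, (a = 0 → Δ ≠ Δ') →
      bicoeff (f - coboundary 0 0 Δ Δ' φ) a 1 = 0 := by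
  -- Division by zero gives the coefficient 0 in the resonant degree i = Δ - Δ', where the
  -- coboundary has no linear term.
  refine ⟨∑ i ∈ (f.coeff 1).support, monomial i ((f.coeff 1).coeff i / (i + Δ' - Δ)), fun a ha => ?_⟩
  rw [bicoeff_sub, bicoeff_coboundary_one, finsetSum_coeff, sub_eq_zero]
  simp only [coeff_monomial]
  rw [Finset.sum_ite_eq' (f.coeff 1).support a (fun i => (f.coeff 1).coeff i / ((i : ℂ) + Δ' - Δ))]
  split_ifs with hs
  · change _ = _ * (bicoeff f a 1 / _)
    by_cases h : (a : ℂ) + Δ' - Δ = 0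
    · rw [h, zero_mul]
      cases a with
      | zero =>
        exact absurd (by push_cast at h; linear_combination -h) (ha rfl)
      | succ a =>
        -- In a positive resonant degree there is nothing to remove: the left side of this relation
        -- vanishes, so Δ' times the linear coefficient is zero.
        have e := hf.bicoeff_add_two 0 a
        simp only [zero_add, Nat.choose_self, Nat.choose_succ_self] at e
        have h' : (((0 : ℕ) : ℂ) + a + 1 + Δ' - Δ) = 0 := by push_cast at h ⊢; linear_combination h
        rw [h'] at e
        push_cast at e
        exact (mul_eq_zero.1 (by linear_combination -e : Δ' * bicoeff f (a + 1) 1 = 0)).resolve_left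
          hΔ'
    · field_simp
  · rw [mul_zero]
    exact notMem_support_iff.1 hs

/-! ### Independence of the coboundary of ∂^k in the coefficients of λ² and λ³ -/

theorem cast_choose_succ (n j : ℕ) :
    (n.choose (j + 1) : ℂ) = n.choose j * (n - j) / (j + 1) := by
  have hj : (j : ℂ) + 1 ≠ 0 := by exact_mod_cast j.succ_ne_zero
  rw [eq_div_iff hj]
  rcases le_or_gt j n with h | h
  · rw [← Nat.cast_sub h]
    exact_mod_cast Nat.choose_succ_right_eq n j
  · simp [Nat.choose_eq_zero_of_lt h, Nat.choose_eq_zero_of_lt (Nat.lt_succ_of_lt h)]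

theorem cast_choose_two (n : ℕ) : (n.choose 2 : ℂ) = n * (n - 1) / 2 :=
  Nat.cast_choose_two ℂ n

theorem cast_choose_three (n : ℕ) : (n.choose 3 : ℂ) = n * (n - 1) * (n - 2) / 6 := by
  rw [cast_choose_succ, cast_choose_two]; push_cast; ring

theorem cast_choose_four (n : ℕ) :
    (n.choose 4 : ℂ) = n * (n - 1) * (n - 2) * (n - 3) / 24 := by
  rw [cast_choose_succ, cast_choose_three]; push_cast; ring

theorem cast_choose_five (n : ℕ) :
    (n.choose 5 : ℂ) = n * (n - 1) * (n - 2) * (n - 3) * (n - 4) / 120 := by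
  rw [cast_choose_succ, cast_choose_four]; push_cast; ring

theorem cast_choose_six (n : ℕ) :
    (n.choose 6 : ℂ) = n * (n - 1) * (n - 2) * (n - 3) * (n - 4) * (n - 5) / 720 := by
  rw [cast_choose_succ, cast_choose_five]; push_cast; ring

theorem cast_choose_seven (n : ℕ) :
    (n.choose 7 : ℂ) = n * (n - 1) * (n - 2) * (n - 3) * (n - 4) * (n - 5) * (n - 6) / 5040 := by
  rw [cast_choose_succ, cast_choose_six]; push_cast; ring

/-- The determinant formed by the coefficients of `λ ^ 2` and `λ ^ 3` of a cocycle (`a₂`, `a₃`)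
and of the coboundary of `∂ ^ k`, divided by `k`. -/
noncomputable def cocycleDet (k D a₂ a₃ : ℂ) : ℂ :=
  ((k - 1) * (k - 2) / 6 + D * (k - 1) / 2) * a₂ - ((k - 1) / 2 + D) * a₃

/-- Here k = n + 5. The relations at λ²μ³, λ²μ⁴, λ²μ⁵ express the coefficients of λ⁴, λ⁵, λ⁶ through
those of λ² and λ³; substituting them at λ³μ⁴ leaves one linear condition. Coboundaries satisfy it,
so it is a multiple of the determinant, the factor being quadratic in Δ'. -/
theorem IsCocycle.cocycleDet_of_five_le {Δ Δ' : ℂ} {f : ℂ[X][X]} (hf : IsCocycle 0 0 Δ Δ' f)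
    (n : ℕ) : ((n + 5) ^ 2 + 4 * (n + 5) * Δ' - 5 * (n + 5) + 4 * Δ' ^ 2 - 4 * Δ')
      * cocycleDet (n + 5) Δ' (bicoeff f (n + 4) 2) (bicoeff f (n + 3) 3) = 0 := by
  have e23 := hf.bicoeff_rel (n + 2) 0 1
  have e24 := hf.bicoeff_rel (n + 1) 0 2
  have e25 := hf.bicoeff_rel n 0 3
  have e34 := hf.bicoeff_rel n 1 2
  simp only [add_zero, zero_add, add_assoc, Nat.reduceAdd, Nat.choose_one_right, cast_choose_two,
    cast_choose_three, cast_choose_four, cast_choose_five, Nat.cast_add, Nat.cast_ofNat,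
    Nat.cast_one] at e23 e24 e25 e34
  generalize bicoeff f (n + 4) 2 = a₂ at *
  generalize bicoeff f (n + 3) 3 = a₃ at *
  generalize bicoeff f (n + 2) 4 = a₄ at *
  generalize bicoeff f (n + 1) 5 = a₅ at *
  generalize bicoeff f n 6 = a₆ at *
  have hn : ((n : ℂ) + 1) * (n + 2) * (n + 3) ≠ 0 := by
    exact_mod_cast (by positivity : (n + 1) * (n + 2) * (n + 3) ≠ 0)
  generalize (n : ℂ) = x at *
  refine (mul_eq_zero.1 ?_).resolve_left hn
  have h4 := eq_div_of_mul_eq (by norm_num) ((mul_comm _ _).trans e23.symm)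
  have h5 := eq_div_of_mul_eq (by norm_num) ((mul_comm _ _).trans e24.symm)
  have h6 := eq_div_of_mul_eq (by norm_num) ((mul_comm _ _).trans e25.symm)
  rw [h6, h5, h4] at e34
  unfold cocycleDet
  linear_combination 72 * e34

/-- With k = n + 7 the relation at λ⁴μ⁵ is also available. It multiplies the determinant by a
quartic in Δ', whose remainder modulo the quadratic found at λ³μ⁴ is a nonzero multiple of k(k - 1).
So the two factors have no common root. -/
theorem IsCocycle.cocycleDet_of_seven_le {Δ Δ' : ℂ} {f : ℂ[X][X]} (hf : IsCocycle 0 0 Δ Δ' f)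
    (n : ℕ) : cocycleDet (n + 7) Δ' (bicoeff f (n + 6) 2) (bicoeff f (n + 5) 3) = 0 := by
  have e := hf.cocycleDet_of_five_le (n + 2)
  have e23 := hf.bicoeff_rel (n + 4) 0 1
  have e24 := hf.bicoeff_rel (n + 3) 0 2
  have e25 := hf.bicoeff_rel (n + 2) 0 3
  have e26 := hf.bicoeff_rel (n + 1) 0 4
  have e27 := hf.bicoeff_rel n 0 5
  have e45 := hf.bicoeff_rel n 2 3
  simp only [add_zero, zero_add, add_assoc, Nat.reduceAdd, Nat.choose_one_right, cast_choose_two,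
    cast_choose_three, cast_choose_four, cast_choose_five, cast_choose_six, cast_choose_seven,
    Nat.cast_add, Nat.cast_ofNat, Nat.cast_one] at e e23 e24 e25 e26 e27 e45
  generalize bicoeff f (n + 6) 2 = a₂ at *
  generalize bicoeff f (n + 5) 3 = a₃ at *
  generalize bicoeff f (n + 4) 4 = a₄ at *
  generalize bicoeff f (n + 3) 5 = a₅ at *
  generalize bicoeff f (n + 2) 6 = a₆ at *
  generalize bicoeff f (n + 1) 7 = a₇ at *
  generalize bicoeff f n 8 = a₈ at *
  have hn : ((n : ℂ) + 1) * (n + 2) * (n + 3) * (n + 4) * (n + 5) ≠ 0 := by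
    exact_mod_cast (by positivity : (n + 1) * (n + 2) * (n + 3) * (n + 4) * (n + 5) ≠ 0)
  have hn' : ((n : ℂ) + 6) * (n + 7) ≠ 0 := by
    exact_mod_cast (by positivity : (n + 6) * (n + 7) ≠ 0)
  generalize (n : ℂ) = x at *
  have h4 := eq_div_of_mul_eq (by norm_num) ((mul_comm _ _).trans e23.symm)
  have h5 := eq_div_of_mul_eq (by norm_num) ((mul_comm _ _).trans e24.symm)
  have h6 := eq_div_of_mul_eq (by norm_num) ((mul_comm _ _).trans e25.symm)
  have h7 := eq_div_of_mul_eq (by norm_num) ((mul_comm _ _).trans e26.symm)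
  have h8 := eq_div_of_mul_eq (by norm_num) ((mul_comm _ _).trans e27.symm)
  rw [h8, h7, h6, h5, h4] at e45
  refine (mul_eq_zero.1 (?_ : ((x + 6) * (x + 7)) * _ = 0)).resolve_left hn'
  refine (mul_eq_zero.1 ?_).resolve_left hn
  unfold cocycleDet at *
  -- The multiplier of `e` is, up to scaling, the quotient in the division of the quartic by the
  -- quadratic.
  linear_combination 3200 * e45 - (x + 1) * (x + 2) * (x + 3) * (x + 4) * (x + 5) / 9
    * ((x + 7) ^ 2 + 4 * (x + 7) * Δ' - 19 * (x + 7) + 4 * Δ' ^ 2 - 44 * Δ' + 57) * e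

theorem bicoeff_add (f g : ℂ[X][X]) (i j : ℕ) :
    bicoeff (f + g) i j = bicoeff f i j + bicoeff g i j := by
  simp [bicoeff]

/-- The coefficient vector of the coboundary of ∂^(n+2) is nonzero, so a vanishing determinant makes
(a₂, a₃) a multiple of it. -/
theorem exists_eq_mul_of_cocycleDet_eq_zero (n : ℕ) {D a₂ a₃ : ℂ}
    (h : cocycleDet (n + 2) D a₂ a₃ = 0) :
    ∃ t : ℂ, a₂ = t * ((n + 2).choose 2 + D * (n + 2).choose 1) ∧
      a₃ = t * ((n + 2).choose 3 + D * (n + 2).choose 2) := by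
  have h1 : (n : ℂ) + 1 ≠ 0 := by exact_mod_cast n.succ_ne_zero
  have h2 : (n : ℂ) + 2 ≠ 0 := by exact_mod_cast (n + 1).succ_ne_zero
  have h3 : (n : ℂ) + 3 ≠ 0 := by exact_mod_cast (n + 2).succ_ne_zero
  rw [cast_choose_two, cast_choose_three, Nat.choose_one_right]
  push_cast
  unfold cocycleDet at h
  -- If the λ² coefficient of the coboundary is zero, the multiple is read off from λ³, otherwise
  -- from λ².
  by_cases hb : ((n : ℂ) + 1) / 2 + D = 0
  · have hD : D = -((n : ℂ) + 1) / 2 := by linear_combination hb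
    subst hD
    refine ⟨-12 * a₃ / ((n + 1) * (n + 2) * (n + 3)), ?_, ?_⟩
    · have : (((n : ℂ) + 1) * (n + 3)) * a₂ = 0 := by linear_combination -12 * h
      rw [(mul_eq_zero.1 this).resolve_left (mul_ne_zero h1 h3)]
      ring
    · field_simp
      ring
  · refine ⟨a₂ / ((n + 2) * ((n + 1) / 2 + D)), ?_, ?_⟩
    · rw [div_mul_eq_mul_div, eq_div_iff (mul_ne_zero h2 hb)]
      ring
    · rw [div_mul_eq_mul_div, eq_div_iff (mul_ne_zero h2 hb)]
      linear_combination -((n : ℂ) + 2) * h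

/-! ### The list in monomials, and leading parts of cocycles -/

theorem listTwo_eq_monomials : lam ^ 2 * (2 * dbar 0 + lam)
    = const 2 * (dbar 0 ^ 1 * lam ^ 2) + dbar 0 ^ 0 * lam ^ 3 := by
  refine eq_of_forall_evalEval_eq fun x l => ?_
  simp only [evalEval_add, evalEval_mul, evalEval_pow, evalEval_const, evalEval_lam,
    evalEval_dbar, evalEval_ofNat]
  ring

theorem listThree_eq_monomials : dbar 0 * lam ^ 2 * (dbar 0 + lam)
    = dbar 0 ^ 2 * lam ^ 2 + dbar 0 ^ 1 * lam ^ 3 := by ring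

theorem listFour_eq_monomials (Δ' : ℂ) :
    lam ^ 2 * (4 * dbar 0 ^ 3 + 6 * dbar 0 ^ 2 * lam - dbar 0 * lam ^ 2 + const Δ' * lam ^ 3)
      = const 4 * (dbar 0 ^ 3 * lam ^ 2) + const 6 * (dbar 0 ^ 2 * lam ^ 3)
        - dbar 0 ^ 1 * lam ^ 4 + const Δ' * (dbar 0 ^ 0 * lam ^ 5) := by
  refine eq_of_forall_evalEval_eq fun x l => ?_
  simp only [evalEval_add, evalEval_sub, evalEval_mul, evalEval_pow, evalEval_const,
    evalEval_lam, evalEval_dbar, evalEval_ofNat]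
  ring

theorem listFive_eq_monomials :
    dbar 0 ^ 4 * lam ^ 2 - 10 * dbar 0 ^ 2 * lam ^ 4 - 17 * dbar 0 * lam ^ 5 - 8 * lam ^ 6
      = dbar 0 ^ 4 * lam ^ 2 - const 10 * (dbar 0 ^ 2 * lam ^ 4)
        - const 17 * (dbar 0 ^ 1 * lam ^ 5) - const 8 * (dbar 0 ^ 0 * lam ^ 6) := by
  refine eq_of_forall_evalEval_eq fun x l => ?_
  simp only [evalEval_sub, evalEval_mul, evalEval_pow, evalEval_const,
    evalEval_lam, evalEval_dbar, evalEval_ofNat]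
  ring

theorem listSix_eq_monomials (Δ' : ℂ) :
    dbar 0 ^ 4 * lam ^ 3
      - const (2 * Δ' + 3) * dbar 0 ^ 3 * lam ^ 4 - const (3 * Δ') * dbar 0 ^ 2 * lam ^ 5
      - const (3 * Δ' + 1) * dbar 0 * lam ^ 6 - const (Δ' + 9 / 28) * lam ^ 7
      = dbar 0 ^ 4 * lam ^ 3 - const (2 * Δ' + 3) * (dbar 0 ^ 3 * lam ^ 4)
        - const (3 * Δ') * (dbar 0 ^ 2 * lam ^ 5) - const (3 * Δ' + 1) * (dbar 0 ^ 1 * lam ^ 6)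
        - const (Δ' + 9 / 28) * (dbar 0 ^ 0 * lam ^ 7) := by ring

theorem listZero_eq_monomials (c₀ c₁ : ℂ) : const c₀ + const c₁ * lam
    = const c₀ * (dbar 0 ^ 0 * lam ^ 0) + const c₁ * (dbar 0 ^ 0 * lam ^ 1) := by ring

/-- Modulo coboundaries and the list, the coefficients of `λ ^ 2` and `λ ^ 3` of `f` vanish in the
degree that `Δ - Δ' = n + 1` selects. -/
def HasListedLeadingPart (Δ Δ' : ℂ) (f : ℂ[X][X]) (n : ℕ) : Prop :=
  ∃ (t : ℂ) (p : ℂ[X][X]), (p = 0 ∨ VirasoroList 0 Δ Δ' p) ∧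
    (∀ i, bicoeff p i 0 = 0) ∧ (∀ i, bicoeff p i 1 = 0) ∧
    bicoeff f n 2 = t * ((n + 1).choose 2 + Δ' * (n + 1).choose 1) + bicoeff p n 2 ∧
    ∀ m, n = m + 1 →
      bicoeff f m 3 = t * ((n + 1).choose 3 + Δ' * (n + 1).choose 2) + bicoeff p m 3

theorem HasListedLeadingPart.of_mul {Δ Δ' : ℂ} {f : ℂ[X][X]} {m : ℕ} (P : ℂ[X][X])
    (hP : ∀ c ≠ 0, VirasoroList 0 Δ Δ' (const c * P)) (h0 : ∀ i, bicoeff P i 0 = 0)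
    (h1 : ∀ i, bicoeff P i 1 = 0) (t c : ℂ)
    (h2 : bicoeff f (m + 1) 2 = t * ((m + 2).choose 2 + Δ' * (m + 2).choose 1)
      + c * bicoeff P (m + 1) 2)
    (h3 : bicoeff f m 3 = t * ((m + 2).choose 3 + Δ' * (m + 2).choose 2) + c * bicoeff P m 3) :
    HasListedLeadingPart Δ Δ' f (m + 1) := by
  refine ⟨t, const c * P, ?_, fun i => ?_, fun i => ?_, ?_, ?_⟩
  · by_cases hc : c = 0
    · left
      simp [hc, const]
    · exact Or.inr (hP c hc)
  · rw [bicoeff_const_mul, h0, mul_zero]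
  · rw [bicoeff_const_mul, h1, mul_zero]
  · rw [bicoeff_const_mul]
    exact h2
  · intro m' hm
    obtain rfl : m = m' := by omega
    rw [bicoeff_const_mul]
    exact h3

theorem HasListedLeadingPart.of_cocycleDet {Δ Δ' : ℂ} {f : ℂ[X][X]} {m : ℕ}
    (h : cocycleDet (m + 2) Δ' (bicoeff f (m + 1) 2) (bicoeff f m 3) = 0) :
    HasListedLeadingPart Δ Δ' f (m + 1) := by
  obtain ⟨t, h2, h3⟩ := exists_eq_mul_of_cocycleDet_eq_zero m h
  refine ⟨t, 0, Or.inl rfl, fun i => bicoeff_zero i 0, fun i => bicoeff_zero i 1, ?_, ?_⟩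
  · rw [bicoeff_zero, add_zero]
    exact h2
  · intro m' hm
    obtain rfl : m = m' := by omega
    rw [bicoeff_zero, add_zero]
    exact h3

theorem eq_neg_five_halves_add {D : ℂ} (h : 2 * D ^ 2 + 10 * D + 3 = 0) :
    ∃ s : ℂ, (s = (√19 : ℝ) ∨ s = -(√19 : ℝ)) ∧ D = -5 / 2 + s / 2 := by
  refine ⟨2 * D + 5, ?_, by ring⟩
  have h' := sq_eq_of_eq_sqrt (Or.inl rfl)
  exact sq_eq_sq_iff_eq_or_eq_neg.1 (by rw [h']; linear_combination 2 * h)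

/-- Where the list has an entry, the λ² and λ³ coefficients of this entry and of the coboundary of
∂^(n+1) are independent, and the witnesses t, c solve the resulting 2 × 2 system. Otherwise the
coboundary alone suffices: for n = 0 because Δ' ≠ 0, in the other cases because the determinant
vanishes. -/
theorem IsCocycle.hasListedLeadingPart {Δ Δ' : ℂ} (hΔ' : Δ' ≠ 0) {f : ℂ[X][X]}
    (hf : IsCocycle 0 0 Δ Δ' f) (n : ℕ) (hn : Δ - Δ' = n + 1) :
    HasListedLeadingPart Δ Δ' f n := by
  match n with
  | 0 =>
    refine ⟨bicoeff f 0 2 / Δ', 0, Or.inl rfl, fun i => bicoeff_zero i 0,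
      fun i => bicoeff_zero i 1, ?_, by intro m hm; omega⟩
    rw [bicoeff_zero]
    simp
    field_simp
  | 1 =>
    refine HasListedLeadingPart.of_mul (m := 0) _
      (fun c hc => VirasoroList.two Δ Δ' c hc (by rw [hn]; norm_num)) ?_ ?_
      (bicoeff f 1 2 - 2 * bicoeff f 0 3)
      (bicoeff f 0 3 - (bicoeff f 1 2 - 2 * bicoeff f 0 3) * Δ') ?_ ?_ <;>
    simp only [listTwo_eq_monomials, bicoeff_add, bicoeff_const_mul, bicoeff_dbar_pow_mul_lam_pow] <;>
    norm_num [Nat.choose]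
    ring
  | 2 =>
    refine HasListedLeadingPart.of_mul (m := 1) _
      (fun c hc => VirasoroList.three Δ Δ' c hc (by rw [hn]; norm_num)) ?_ ?_
      ((bicoeff f 2 2 - bicoeff f 1 3) / 2)
      (bicoeff f 2 2 - (bicoeff f 2 2 - bicoeff f 1 3) / 2 * (3 + 3 * Δ')) ?_ ?_ <;>
    simp only [listThree_eq_monomials, bicoeff_add, bicoeff_dbar_pow_mul_lam_pow] <;>
    norm_num [Nat.choose] <;>
    ring
  | 3 =>
    refine HasListedLeadingPart.of_mul (m := 2) _
      (fun c hc => VirasoroList.four Δ Δ' c hc (by rw [hn]; norm_num)) ?_ ?_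
      ((6 * bicoeff f 3 2 - 4 * bicoeff f 2 3) / 20)
      ((bicoeff f 3 2 - (6 * bicoeff f 3 2 - 4 * bicoeff f 2 3) / 20 * (6 + 4 * Δ')) / 4)
      ?_ ?_ <;>
    simp only [listFour_eq_monomials, bicoeff_add, bicoeff_sub, bicoeff_const_mul, bicoeff_dbar_pow_mul_lam_pow] <;>
    norm_num [Nat.choose] <;>
    ring
  | 4 =>
    -- For k = 5 the quadratic factor of the determinant relation is 4Δ'(Δ' + 4).
    by_cases hD : Δ' = -4
    · refine HasListedLeadingPart.of_mul (m := 3) _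
        (fun c hc => VirasoroList.five Δ Δ' c hc
          (by rw [hD] at hn; push_cast at hn; linear_combination hn) hD) ?_ ?_
        (-bicoeff f 3 3 / 30) (bicoeff f 4 2 - bicoeff f 3 3 / 3) ?_ ?_ <;>
      simp only [listFive_eq_monomials, bicoeff_sub, bicoeff_const_mul, bicoeff_dbar_pow_mul_lam_pow, hD] <;>
      norm_num [Nat.choose]
      ring
    · have e := hf.cocycleDet_of_five_le 0
      have hq : Δ' * (Δ' + 4) ≠ 0 :=
        mul_ne_zero hΔ' fun h => hD (by linear_combination h)
      refine HasListedLeadingPart.of_cocycleDet (m := 3) ?_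
      norm_num at e ⊢
      refine e.resolve_left fun h => hq (by linear_combination h / 4)
  | 5 =>
    -- For k = 6 the factor is twice this quadratic.
    by_cases hD : 2 * Δ' ^ 2 + 10 * Δ' + 3 = 0
    · obtain ⟨s, hs, hs'⟩ := eq_neg_five_halves_add hD
      -- This is the λ² coefficient of the coboundary of ∂⁶. The listed polynomial has no λ² term,
      -- so t is obtained by dividing by it.
      have hb : 15 + 6 * Δ' ≠ 0 := fun h => by
        have : Δ' = -5 / 2 := by linear_combination h / 6
        rw [this] at hD
        norm_num at hD
      refine HasListedLeadingPart.of_mul (m := 4) _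
        (fun c hc => VirasoroList.six Δ Δ' c s hc hs
          (by push_cast at hn; linear_combination hn + hs') hs') ?_ ?_
        (bicoeff f 5 2 / (15 + 6 * Δ'))
        (bicoeff f 4 3 - bicoeff f 5 2 / (15 + 6 * Δ') * (20 + 15 * Δ')) ?_ ?_ <;>
      simp only [listSix_eq_monomials, bicoeff_sub, bicoeff_const_mul, bicoeff_dbar_pow_mul_lam_pow] <;>
      norm_num [Nat.choose] <;>
      field_simp
      ring
    · have e := hf.cocycleDet_of_five_le 1
      refine HasListedLeadingPart.of_cocycleDet (m := 4) ?_
      norm_num at e ⊢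
      refine e.resolve_left fun h => hD (by linear_combination h / 2)
  | n + 6 =>
    refine HasListedLeadingPart.of_cocycleDet (m := n + 5) ?_
    have e := hf.cocycleDet_of_seven_le n
    rw [← e]
    congr 1
    push_cast
    ring

theorem isCocycle_zero (α α' Δ Δ' : ℂ) : IsCocycle α α' Δ Δ' 0 := by
  intro x l m
  simp

theorem IsCocycle.exists_sub_coboundary_mem {Δ Δ' : ℂ} (hΔ' : Δ' ≠ 0) {f : ℂ[X][X]}
    (hf : IsCocycle 0 0 Δ Δ' f) : ∃ φ : ℂ[X], f - coboundary 0 0 Δ Δ' φ = 0 ∨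
      VirasoroList 0 Δ Δ' (f - coboundary 0 0 Δ Δ' φ) := by
  obtain ⟨φ, hφ⟩ := hf.exists_bicoeff_one_eq hΔ'
  have hg := hf.sub (isCocycle_coboundary 0 0 Δ Δ' φ)
  by_cases hΔ : Δ = Δ'
  · refine ⟨φ, ?_⟩
    generalize f - coboundary 0 0 Δ Δ' φ = g at *
    -- For Δ = Δ' no λ² or λ³ term is selected, so only the constant and the multiple of λ can
    -- survive.
    have key : ∀ p, IsCocycle 0 0 Δ Δ' p →
        p = const (bicoeff g 0 0) + const (bicoeff g 0 1) * lam → g - p = 0 := by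
      intro p hp hpe
      have hb : ∀ a, bicoeff p a 1 = if a = 0 then bicoeff g 0 1 else 0 := fun a => by
        rw [hpe, listZero_eq_monomials]
        simp only [bicoeff_add, bicoeff_const_mul, bicoeff_dbar_pow_mul_lam_pow]
        simp
      have hne : ∀ a : ℕ, (a : ℂ) + 1 ≠ 0 := fun a => by exact_mod_cast a.succ_ne_zero
      have hne' : ∀ a : ℕ, (a : ℂ) + 2 ≠ 0 := fun a => by exact_mod_cast (a + 1).succ_ne_zero
      refine (hg.sub hp).eq_zero hΔ' ?_ (fun a => ?_)
        (fun a ha => absurd (by rw [← ha, hΔ, sub_self]) (hne a))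
        (fun a ha => absurd (by rw [← ha, hΔ, sub_self]) (hne' a))
      · rw [bicoeff_sub, hpe, listZero_eq_monomials]
        simp only [bicoeff_add, bicoeff_const_mul, bicoeff_dbar_pow_mul_lam_pow]
        simp
      · rw [bicoeff_sub, hb]
        split_ifs with h
        · rw [h, sub_self]
        · rw [hφ a (fun h' => absurd h' h), sub_zero]
    by_cases hc : (bicoeff g 0 0, bicoeff g 0 1) = (0, 0)
    · left
      rw [Prod.mk.injEq] at hc
      rw [← sub_zero g]
      exact key 0 (isCocycle_zero 0 0 Δ Δ') (by rw [hc.1, hc.2]; simp [const])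
    · right
      have hV := VirasoroList.zero (α := 0) Δ Δ' _ _ hc hΔ
      rwa [← sub_eq_zero.1 (key _ hV.isCocycle rfl)] at hV
  have h0 : bicoeff (f - coboundary 0 0 Δ Δ' φ) 0 0 = 0 :=
    (mul_eq_zero.1 hg.bicoeff_zero_zero).resolve_left (sub_ne_zero.2 hΔ)
  have h1 := fun a => hφ a fun _ => hΔ
  by_cases hn : ∃ n : ℕ, Δ - Δ' = n + 1
  · obtain ⟨n, hn⟩ := hn
    obtain ⟨t, p, hp, hp0, hp1, h2, h3⟩ := hg.hasListedLeadingPart hΔ' n hn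
    have hpc : IsCocycle 0 0 Δ Δ' p := by
      rcases hp with rfl | hp
      · exact isCocycle_zero 0 0 Δ Δ'
      · exact hp.isCocycle
    -- Since n + 1 = Δ - Δ', the added coboundary has no linear term, so the normalization by φ is
    -- preserved.
    refine ⟨φ + monomial (n + 1) t, ?_⟩
    have key : f - coboundary 0 0 Δ Δ' (φ + monomial (n + 1) t) = p := by
      rw [coboundary_add, ← sub_sub, ← sub_eq_zero]
      refine ((hg.sub (isCocycle_coboundary 0 0 Δ Δ' _)).sub hpc).eq_zero hΔ' ?_ ?_ ?_ ?_
      · rw [bicoeff_sub, bicoeff_sub, h0, bicoeff_coboundary_zero, hp0]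
        ring
      · intro a
        rw [bicoeff_sub, bicoeff_sub, h1, bicoeff_coboundary_one, hp1, coeff_monomial]
        split_ifs with h
        · subst h
          push_cast
          linear_combination t * hn
        · ring
      · intro a ha
        obtain rfl : n = a := by
          have := hn.symm.trans ha
          exact_mod_cast add_right_cancel this
        rw [bicoeff_sub, bicoeff_sub, h2, bicoeff_coboundary_add_two]
        simp only [add_zero, zero_add, coeff_monomial, if_true]
        ring
      · intro a ha
        obtain rfl : n = a + 1 := by
          have : (n : ℂ) + 1 = (a + 1 : ℕ) + 1 := by
            rw [← hn, ha]
            push_cast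
            ring
          exact_mod_cast add_right_cancel this
        rw [bicoeff_sub, bicoeff_sub, h3 a rfl, show 3 = 1 + 2 by rfl, bicoeff_coboundary_add_two]
        simp only [coeff_monomial, if_true, Nat.reduceAdd]
        ring
    rwa [key]
  · refine ⟨φ, Or.inl (hg.eq_zero hΔ' h0 h1 (fun a ha => absurd ⟨a, ha⟩ hn) fun a ha => ?_)⟩
    exact absurd ⟨a + 1, by rw [ha]; push_cast; ring⟩ hn

/-! ### Translation in `∂` -/

/-- The polynomial `f(∂ + β, λ)`. -/
noncomputable def shift (β : ℂ) (f : ℂ[X][X]) : ℂ[X][X] := f.map (compRingHom (X + C β))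

theorem evalEval_shift (β : ℂ) (f : ℂ[X][X]) (x l : ℂ) :
    (shift β f).evalEval x l = f.evalEval (x + β) l := by
  have h : (C l : ℂ[X]) = compRingHom (X + C β) (C l) := by simp
  rw [shift, evalEval, h, eval_map, eval₂_at_apply, coe_compRingHom_apply, eval_comp, evalEval]
  simp

theorem shift_shift_neg (β : ℂ) (f : ℂ[X][X]) : shift β (shift (-β) f) = f :=
  eq_of_forall_evalEval_eq fun x l => by
    rw [evalEval_shift, evalEval_shift, add_neg_cancel_right]

theorem shift_sub (β : ℂ) (f g : ℂ[X][X]) : shift β (f - g) = shift β f - shift β g := by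
  simp [shift]

theorem shift_zero_right (β : ℂ) : shift β 0 = 0 := by
  simp [shift]

theorem shift_coboundary (α β Δ Δ' : ℂ) (φ : ℂ[X]) : shift β (coboundary α α Δ Δ' φ)
    = coboundary (α + β) (α + β) Δ Δ' (φ.comp (X + C β)) :=
  eq_of_forall_evalEval_eq fun x l => by
    rw [evalEval_shift, evalEval_coboundary, evalEval_coboundary]
    simp only [eval_comp, eval_add, eval_X, eval_C]
    rw [show x + l + β = x + β + l by ring]
    ring

theorem IsCocycle.shift_neg {α Δ Δ' : ℂ} {f : ℂ[X][X]} (hf : IsCocycle α α Δ Δ' f) :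
    IsCocycle 0 0 Δ Δ' (shift (-α) f) := by
  intro x l m
  have e := hf (x + -α) l m
  simp only [evalEval_shift]
  rw [show x + l + -α = x + -α + l by ring, show x + m + -α = x + -α + m by ring]
  linear_combination e

theorem IsYCocycle.shift_neg {α Δ Δ' : ℂ} {f : ℂ[X][X]} (hf : IsYCocycle α α Δ Δ' f) :
    IsYCocycle 0 0 Δ Δ' (shift (-α) f) := by
  intro x l m
  have e := hf (x + -α) l m
  simp only [evalEval_shift]
  rw [show x + l + -α = x + -α + l by ring]
  linear_combination e

theorem VirasoroList.shift {α Δ Δ' : ℂ} {f : ℂ[X][X]} (hf : VirasoroList α Δ Δ' f) (β : ℂ) :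
    VirasoroList (α + β) Δ Δ' (shift β f) := by
  cases hf with
  | zero c₀ c₁ hc hΔ =>
    convert VirasoroList.zero Δ Δ' c₀ c₁ hc hΔ
    refine eq_of_forall_evalEval_eq fun x l => ?_
    simp only [evalEval_shift, evalEval_add, evalEval_mul, evalEval_const, evalEval_lam]
  | two c hc hΔ =>
    convert VirasoroList.two Δ Δ' c hc hΔ
    refine eq_of_forall_evalEval_eq fun x l => ?_
    simp only [evalEval_shift, evalEval_add, evalEval_mul, evalEval_pow, evalEval_const,
      evalEval_lam, evalEval_dbar, evalEval_ofNat]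
    ring
  | three c hc hΔ =>
    convert VirasoroList.three Δ Δ' c hc hΔ
    refine eq_of_forall_evalEval_eq fun x l => ?_
    simp only [evalEval_shift, evalEval_add, evalEval_mul, evalEval_pow, evalEval_const,
      evalEval_lam, evalEval_dbar]
    ring
  | four c hc hΔ =>
    convert VirasoroList.four Δ Δ' c hc hΔ
    refine eq_of_forall_evalEval_eq fun x l => ?_
    simp only [evalEval_shift, evalEval_add, evalEval_sub, evalEval_mul, evalEval_pow,
      evalEval_const, evalEval_lam, evalEval_dbar, evalEval_ofNat]
    ring
  | five c hc hΔ hΔ' =>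
    convert VirasoroList.five Δ Δ' c hc hΔ hΔ'
    refine eq_of_forall_evalEval_eq fun x l => ?_
    simp only [evalEval_shift, evalEval_sub, evalEval_mul, evalEval_pow,
      evalEval_const, evalEval_lam, evalEval_dbar, evalEval_ofNat]
    ring
  | six c s hc hs hΔ hΔ' =>
    convert VirasoroList.six Δ Δ' c s hc hs hΔ hΔ'
    refine eq_of_forall_evalEval_eq fun x l => ?_
    simp only [evalEval_shift, evalEval_sub, evalEval_mul, evalEval_pow,
      evalEval_const, evalEval_lam, evalEval_dbar]
    ring

/-- A cocycle is cohomologous to zero or to a polynomial in the list. -/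
theorem IsCocycle.exists_sub_coboundary {α Δ Δ' : ℂ} (hΔ' : Δ' ≠ 0) {f : ℂ[X][X]}
    (hf : IsCocycle α α Δ Δ' f) : ∃ φ : ℂ[X], f - coboundary α α Δ Δ' φ = 0 ∨
      VirasoroList α Δ Δ' (f - coboundary α α Δ Δ' φ) := by
  obtain ⟨φ, hφ⟩ := hf.shift_neg.exists_sub_coboundary_mem hΔ'
  refine ⟨φ.comp (X + C α), ?_⟩
  have h : f - coboundary α α Δ Δ' (φ.comp (X + C α))
      = SV.shift α (SV.shift (-α) f - coboundary 0 0 Δ Δ' φ) := by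
    rw [shift_sub, shift_shift_neg, shift_coboundary, zero_add]
  rw [h]
  rcases hφ with hφ | hφ
  · left
    rw [hφ, shift_zero_right]
  · right
    have := hφ.shift α
    rwa [zero_add] at this

/-! ### The cocycles in the list are not coboundaries -/

/-- For Δ = Δ' a coboundary has neither a constant term nor a term cλ. In the other cases only the
coefficient of φ of degree k = Δ - Δ' enters the relevant monomials, and two coefficients of the
polynomial make inconsistent demands on it. -/
theorem VirasoroList.ne_coboundary_of_zero {Δ Δ' : ℂ} (hΔ' : Δ' ≠ 0) {f : ℂ[X][X]}
    (hf : VirasoroList 0 Δ Δ' f) (φ : ℂ[X]) : f ≠ coboundary 0 0 Δ Δ' φ := by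
  intro h
  have h0 := fun a => congrArg (bicoeff · a 0) h
  have h1 := fun a => congrArg (bicoeff · a 1) h
  have h2 := fun a b => congrArg (bicoeff · a (b + 2)) h
  simp only [bicoeff_coboundary_zero, bicoeff_coboundary_one, bicoeff_coboundary_add_two]
    at h0 h1 h2
  cases hf with
  | zero c₀ c₁ hc hΔ =>
    have e0 := h0 0
    have e1 := h1 0
    simp only [listZero_eq_monomials, bicoeff_add, bicoeff_const_mul,
      bicoeff_dbar_pow_mul_lam_pow] at e0 e1
    simp [hΔ] at e0 e1
    exact hc (by rw [e0, e1])
  | two c hc hΔ =>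
    have e2 := h2 1 0
    have e3 := h2 0 1
    simp only [listTwo_eq_monomials, bicoeff_add, bicoeff_const_mul,
      bicoeff_dbar_pow_mul_lam_pow] at e2 e3
    norm_num [Nat.choose] at e2 e3
    exact hc (by
      have : φ.coeff 2 = 0 := by linear_combination 2 * e3 - e2
      rw [e3, this, mul_zero])
  | three c hc hΔ =>
    have e2 := h2 2 0
    -- The listed polynomial has no λ⁴ term, while that of the coboundary is Δ' times the cubic
    -- coefficient of φ.
    have e4 := h2 0 2
    simp only [listThree_eq_monomials, bicoeff_add, bicoeff_const_mul,
      bicoeff_dbar_pow_mul_lam_pow] at e2 e4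
    norm_num [Nat.choose, hΔ'] at e2 e4
    rw [e4, mul_zero] at e2
    exact hc e2
  | four c hc hΔ =>
    have e2 := h2 3 0
    have e3 := h2 2 1
    simp only [listFour_eq_monomials, bicoeff_add, bicoeff_sub, bicoeff_const_mul,
      bicoeff_dbar_pow_mul_lam_pow] at e2 e3
    norm_num [Nat.choose] at e2 e3
    have : φ.coeff 4 = 0 := by linear_combination (4 * e3 - 6 * e2) / 20
    rw [this, mul_zero] at e2
    exact hc (by linear_combination e2 / 4)
  | five c hc hΔ hD =>
    have e2 := h2 4 0
    have e3 := h2 3 1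
    simp only [listFive_eq_monomials, bicoeff_sub, bicoeff_const_mul,
      bicoeff_dbar_pow_mul_lam_pow] at e2 e3
    norm_num [Nat.choose, hD] at e2 e3
    rw [e3, mul_zero, neg_zero] at e2
    exact hc e2
  | six c s hc hs hΔ hD =>
    have e2 := h2 5 0
    have e3 := h2 4 1
    simp only [listSix_eq_monomials, bicoeff_sub, bicoeff_const_mul,
      bicoeff_dbar_pow_mul_lam_pow] at e2 e3
    norm_num [Nat.choose] at e2 e3
    have hs0 : 15 + Δ' * 6 ≠ 0 := fun h => by
      have h19 := sq_eq_of_eq_sqrt hs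
      have : s = 0 := by rw [hD] at h; linear_combination h / 3
      norm_num [this] at h19
    rcases e2 with e2 | e2
    · exact hs0 e2
    · rw [e2, mul_zero] at e3
      exact hc e3

theorem VirasoroList.ne_coboundary {α Δ Δ' : ℂ} (hΔ' : Δ' ≠ 0) {f : ℂ[X][X]}
    (hf : VirasoroList α Δ Δ' f) (φ : ℂ[X]) : f ≠ coboundary α α Δ Δ' φ := by
  intro h
  have hs := hf.shift (-α)
  rw [add_neg_cancel] at hs
  refine hs.ne_coboundary_of_zero hΔ' (φ.comp (X + C (-α))) ?_
  rw [h, shift_coboundary, add_neg_cancel]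

/-! ### Classification for the action of `Y` -/

/-- If the coefficient of the pure power of ∂ were zero, `bicoeff_succ` would kill every other
coefficient of the same degree. -/
theorem IsYCocycle.exists_degree {Δ Δ' : ℂ} {h : ℂ[X][X]} (hh : IsYCocycle 0 0 Δ Δ' h)
    (h0 : h ≠ 0) : ∃ n : ℕ, Δ - Δ' = n - 1 / 2 ∧ (∀ i j, i + j ≠ n → bicoeff h i j = 0) ∧
      bicoeff h n 0 ≠ 0 := by
  obtain ⟨a, c, hac⟩ : ∃ a c, bicoeff h a c ≠ 0 := by
    by_contra! H
    exact h0 (ext_bicoeff fun i j => by rw [H, bicoeff_zero])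
  have hn := (hh.bicoeff_eq_zero_or a c).resolve_left hac
  refine ⟨a + c, by rw [hn]; push_cast; ring, fun i j hij => ?_, fun H => hac ?_⟩
  · refine (hh.bicoeff_eq_zero_or i j).resolve_right fun h' => hij ?_
    have : (i : ℂ) + j = a + c := by linear_combination hn - h'
    exact_mod_cast this
  · cases c with
    | zero => exact H
    | succ c => rw [hh.bicoeff_succ, show a + c + 1 = a + (c + 1) by ring, H, mul_zero]

theorem IsYCocycle.eq_zero_or_mem {Δ Δ' : ℂ} (hΔ' : Δ' ≠ 0) {h : ℂ[X][X]}
    (hh : IsYCocycle 0 0 Δ Δ' h) :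
    h = 0 ∨ (Δ - Δ' = -1 / 2 ∧ ∃ a ≠ 0, h = const a) ∨
      (Δ - Δ' = 1 / 2 ∧ ∃ a ≠ 0, h = const a * (dbar 0 + const (2 * Δ') * lam)) ∨
      (Δ = 1 ∧ Δ' = -1 / 2 ∧ ∃ a ≠ 0, h = const a * (dbar 0 ^ 2 - lam ^ 2)) := by
  by_cases h0 : h = 0
  · exact Or.inl h0
  right
  obtain ⟨n, hn, hd, ha⟩ := hh.exists_degree h0
  match n with
  | 0 =>
    refine Or.inl ⟨by rw [hn]; norm_num, _, ha, ext_bicoeff fun i j => ?_⟩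
    rw [show const (bicoeff h 0 0) = const (bicoeff h 0 0) * (dbar 0 ^ 0 * lam ^ 0) by ring,
      bicoeff_const_mul, bicoeff_dbar_pow_mul_lam_pow]
    split_ifs with hij
    · rw [hij.1, hij.2, mul_one]
    · rw [hd i j (by omega), mul_zero]
  | 1 =>
    refine Or.inr (Or.inl ⟨by rw [hn]; norm_num, _, ha, ext_bicoeff fun i j => ?_⟩)
    rw [show dbar 0 + const (2 * Δ') * lam
      = dbar 0 ^ 1 * lam ^ 0 + const (2 * Δ') * (dbar 0 ^ 0 * lam ^ 1) by ring]
    simp only [bicoeff_add, bicoeff_const_mul, bicoeff_dbar_pow_mul_lam_pow]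
    have e := hh.bicoeff_succ 0 0
    norm_num at e
    by_cases hij : i + j = 1
    · obtain ⟨rfl, rfl⟩ | ⟨rfl, rfl⟩ : (i = 1 ∧ j = 0) ∨ (i = 0 ∧ j = 1) := by omega
      · simp
      · simp [e]; ring
    · rw [hd i j hij, if_neg (by omega), if_neg (by omega)]
      ring
  | 2 =>
    have e1 := hh.bicoeff_succ 1 0
    have e2 := hh.bicoeff_succ 0 1
    have e3 := hh.bicoeff_zero_add_two 0
    norm_num [Nat.choose, hΔ'] at e1 e2 e3
    -- In degree two there are two expressions for the ∂λ coefficient: 2(1 + 2Δ') times that of ∂²,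
    -- and zero.
    have hD : Δ' = -1 / 2 := by
      have : 2 * (1 + Δ' * 2) = 0 := (mul_eq_zero.1 (e1.symm.trans e3)).resolve_right ha
      linear_combination this / 4
    refine Or.inr (Or.inr ⟨?_, hD, _, ha, ext_bicoeff fun i j => ?_⟩)
    · rw [hD] at hn
      push_cast at hn
      linear_combination hn
    rw [show (dbar 0 ^ 2 - lam ^ 2) = dbar 0 ^ 2 * lam ^ 0 - dbar 0 ^ 0 * lam ^ 2 by ring]
    simp only [bicoeff_sub, bicoeff_const_mul, bicoeff_dbar_pow_mul_lam_pow]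
    by_cases hij : i + j = 2
    · obtain ⟨rfl, rfl⟩ | ⟨rfl, rfl⟩ | ⟨rfl, rfl⟩ :
        (i = 2 ∧ j = 0) ∨ (i = 1 ∧ j = 1) ∨ (i = 0 ∧ j = 2) := by omega
      · simp
      · simp [e3]
      · simp [e2, hD]; ring
    · rw [hd i j hij, if_neg (by omega), if_neg (by omega)]
      ring
  | m + 3 =>
    exfalso
    have e1 := hh.bicoeff_succ (m + 2) 0
    have e2 := hh.bicoeff_succ 1 (m + 1)
    have e3 := hh.bicoeff_succ 0 (m + 2)
    have e4 := hh.bicoeff_zero_add_two (m + 1)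
    have e5 := hh.bicoeff_one_add_two m
    rw [show 1 + (m + 1) + 1 = m + 3 by ring, show m + 1 + 2 = m + 3 by rfl,
      show m + 1 + 1 = m + 2 by rfl] at e2
    simp only [add_assoc, zero_add, Nat.reduceAdd, Nat.choose_self, Nat.choose_succ_self,
      Nat.choose_succ_self_right, Nat.choose_one_right, cast_choose_two] at e1 e2 e3 e4 e5
    push_cast at e1 e2 e3 e4 e5
    -- Two compatibility conditions, from ∂⁰ and ∂¹, each divided by the nonzero leading
    -- coefficient. Eliminating Δ' between them leaves (m + 2)(m + 1) = 0; at m = -1, that is in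
    -- degree two, this would be no contradiction.
    have hS : ((m : ℂ) + 3) * (m + 2) / 2 + Δ' * (m + 3) - (m + 1) / 2 = 0 := by
      refine (mul_eq_zero.1 ?_).resolve_left
        (mul_ne_zero (mul_ne_zero two_ne_zero hΔ') ha : 2 * Δ' * bicoeff h (m + 3) 0 ≠ 0)
      linear_combination e4 - Δ' * e1 + (m + 1) / 2 * e3
    have hT : 1 + 2 * Δ' = 0 := by
      refine (mul_eq_zero.1 ?_).resolve_left ha
      linear_combination e5 - (1 + Δ' * (m + 2)) * e1 + m / 2 * e2
        - 2 * (1 + Δ' * (m + 2)) * bicoeff h (m + 3) 0 * hS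
    have hm : ((m : ℂ) + 2) * (m + 1) ≠ 0 := by
      exact_mod_cast (by positivity : (m + 2) * (m + 1) ≠ 0)
    exact hm (by linear_combination 2 * hS - (m + 3) * hT)

theorem IsYCocycle.eq_zero_or_extensionList {α Δ Δ' : ℂ} (hΔ' : Δ' ≠ 0) {h : ℂ[X][X]}
    (hh : IsYCocycle α α Δ Δ' h) : h = 0 ∨ (ExtensionList α Δ Δ' 0 0 h ∧
      (Δ - Δ' = -1 / 2 ∨ Δ - Δ' = 1 / 2 ∨ Δ - Δ' = 3 / 2)) := by
  have hs := shift_shift_neg α h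
  rcases hh.shift_neg.eq_zero_or_mem hΔ' with e | ⟨hΔ, a, ha, e⟩ | ⟨hΔ, a, ha, e⟩ |
    ⟨hΔ, hD, a, ha, e⟩
  · left
    rw [← hs, e, shift_zero_right]
  · refine Or.inr ⟨?_, Or.inl hΔ⟩
    rw [← hs, e]
    convert ExtensionList.neg_half Δ Δ' a ha hΔ
    refine eq_of_forall_evalEval_eq fun x l => ?_
    simp only [evalEval_shift, evalEval_const]
  · refine Or.inr ⟨?_, Or.inr (Or.inl hΔ)⟩
    rw [← hs, e]
    convert ExtensionList.half Δ Δ' a ha hΔ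
    refine eq_of_forall_evalEval_eq fun x l => ?_
    simp only [evalEval_shift, evalEval_const, evalEval_mul, evalEval_add, evalEval_dbar,
      evalEval_lam, add_zero]
  · refine Or.inr ⟨?_, Or.inr (Or.inr (by rw [hΔ, hD]; norm_num))⟩
    rw [← hs, e]
    convert ExtensionList.three_halves Δ Δ' a ha hΔ hD
    refine eq_of_forall_evalEval_eq fun x l => ?_
    simp only [evalEval_shift, evalEval_const, evalEval_mul, evalEval_sub, evalEval_pow,
      evalEval_dbar, evalEval_lam, add_zero]

end SV

/-! ### Conformal modules as modules over `ℂ[∂]` -/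

theorem aeval_mul_X_apply {V : Type*} [AddCommGroup V] [Module ℂ V] (N : Module.End ℂ V)
    (p : ℂ[X]) (v : V) : aeval N (p * X) v = aeval N p (N v) := by
  rw [map_mul, aeval_X, Module.End.mul_apply]

theorem ConformalModule.IsHom.map_aeval {R : Type*} [AddCommGroup R] [Module ℂ R]
    {A : LieConformalAlgebra R} {V W : Type*} [AddCommGroup V] [Module ℂ V] [AddCommGroup W]
    [Module ℂ W] {MV : ConformalModule A V} {MW : ConformalModule A W} {φ : V →ₗ[ℂ] W}
    (hφ : MV.IsHom MW φ) (p : ℂ[X]) (v : V) :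
    φ (aeval MV.D p v) = aeval MW.D p (φ v) := by
  induction p using Polynomial.induction_on generalizing v with
  | C c => simp
  | add p q hp hq => simp [hp, hq]
  | monomial n c ih =>
    rw [pow_succ, ← mul_assoc, aeval_mul_X_apply, aeval_mul_X_apply, ih, hφ.1]

theorem ConformalModule.act_aeval {R : Type*} [AddCommGroup R] [Module ℂ R]
    {A : LieConformalAlgebra R} {V : Type*} [AddCommGroup V] [Module ℂ V]
    (N : ConformalModule A V) (l : ℂ) (a : R) (p : ℂ[X]) (v : V) :
    N.act l a (aeval N.D p v) = aeval N.D (p.comp (X + C l)) (N.act l a v) := by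
  induction p using Polynomial.induction_on generalizing v with
  | C c => simp
  | add p q hp hq => simp [hp, hq]
  | monomial n c ih =>
    have h : N.act l a (N.D v) = aeval N.D (X + C l) (N.act l a v) := by
      have e := N.D_act l a v
      rw [sub_eq_iff_eq_add] at e
      simp [e]
    rw [pow_succ, ← mul_assoc, aeval_mul_X_apply, ih, h, ← Module.End.mul_apply, ← map_mul,
      mul_comp _ X, X_comp]

theorem ConformalModule.act_aeval_left {R : Type*} [AddCommGroup R] [Module ℂ R]
    {A : LieConformalAlgebra R} {V : Type*} [AddCommGroup V] [Module ℂ V]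
    (N : ConformalModule A V) (l : ℂ) (a : R) (p : ℂ[X]) (v : V) :
    N.act l (aeval A.D p a) v = p.eval (-l) • N.act l a v := by
  induction p using Polynomial.induction_on generalizing a with
  | C c => simp
  | add p q hp hq => simp [hp, hq, add_smul]
  | monomial n c ih =>
    rw [pow_succ, ← mul_assoc, aeval_mul_X_apply, ih, N.act_D, eval_mul_X, mul_smul, neg_smul]

namespace SV

theorem aeval_D_apply (p : ℂ[X]) (a : SV) (z : SVGen) : aeval D p a z = p * a z := by
  induction p using Polynomial.induction_on generalizing a with
  | C c => simp [smul_eq_C_mul]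
  | add p q hp hq => simp [hp, hq, add_mul]
  | monomial n c ih =>
    rw [pow_succ, ← mul_assoc, aeval_mul_X_apply, ih, D_apply]
    ring

theorem eq_sum_aeval_gen (a : SV) : a = ∑ x, aeval D (a x) (gen x) := by
  ext1 z
  simp only [Finset.sum_apply, aeval_D_apply, gen]
  rw [sum_gen]
  cases z <;> simp

/-- By sesquilinearity ∂ in the left argument becomes -λ, so three generators determine the action.
-/
theorem act_eq_sum {E : Type*} [AddCommGroup E] [Module ℂ E]
    (N : ConformalModule conformalAlgebra E) (l : ℂ) (a : SV) (v : E) :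
    N.act l a v = (a .L).eval (-l) • N.act l (gen .L) v + (a .M).eval (-l) • N.act l (gen .M) v
      + (a .Y).eval (-l) • N.act l (gen .Y) v := by
  have h : ∀ x, N.act l (aeval D (a x) (gen x)) v = (a x).eval (-l) • N.act l (gen x) v :=
    fun x => N.act_aeval_left l (gen x) (a x) v
  conv_lhs => rw [eq_sum_aeval_gen a, sum_gen]
  simp only [map_add, LinearMap.add_apply, h]

/-- The `λ`-action on `ℂ[∂] v' ⊕ ℂ[∂] v` given by `f, g, h`. -/
noncomputable def pairAct (α α' Δ Δ' : ℂ) (f g h : ℂ[X][X]) (l : ℂ) (a : SV)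
    (x : ℂ[X] × ℂ[X]) : ℂ[X] × ℂ[X] :=
  (C ((a .L).eval (-l)) *
      (x.1.comp (X + C l) * (X + C α' + C (Δ' * l)) + x.2.comp (X + C l) * f.eval (C l))
    + C ((a .M).eval (-l)) * (x.2.comp (X + C l) * g.eval (C l))
    + C ((a .Y).eval (-l)) * (x.2.comp (X + C l) * h.eval (C l)),
    C ((a .L).eval (-l)) * (x.2.comp (X + C l) * (X + C α + C (Δ * l))))

/-! ### Generators of an extension and change of generator -/

section Generator

variable {α α' Δ Δ' : ℂ} {E : Type*} [AddCommGroup E] [Module ℂ E]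
  {E' : Type*} [AddCommGroup E'] [Module ℂ E']

/-- The map `(q, p) ↦ q(∂) v' + p(∂) v`. -/
noncomputable def lift (S : ConformalExtension (rankOne α' Δ') (rankOne α Δ) E) (v : E) :
    ℂ[X] × ℂ[X] →ₗ[ℂ] E :=
  S.i.coprod ((LinearMap.applyₗ v).comp (aeval S.toModule.D).toLinearMap)

theorem lift_apply (S : ConformalExtension (rankOne α' Δ') (rankOne α Δ) E) (v : E)
    (x : ℂ[X] × ℂ[X]) : lift S v x = S.i x.1 + aeval S.toModule.D x.2 v := rfl

theorem rankOne_act (α Δ l : ℂ) (a : SV) (p : ℂ[X]) : (rankOne α Δ).act l a p =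
    C ((a .L).eval (-l)) * p.comp (X + C l) * (X + C α + C (Δ * l)) := rfl

theorem aeval_rankOne_D (α Δ : ℂ) (p q : ℂ[X]) : aeval (rankOne α Δ).D p q = p * q := by
  induction p using Polynomial.induction_on generalizing q with
  | C c => simp [smul_eq_C_mul]
  | add p q hp hq => simp [hp, hq, add_mul]
  | monomial n c ih =>
    rw [pow_succ, ← mul_assoc, aeval_mul_X_apply, ih]
    change _ * (X * q) = _
    ring

theorem aeval_lift (S : ConformalExtension (rankOne α' Δ') (rankOne α Δ) E) (v : E)
    (r : ℂ[X]) (x : ℂ[X] × ℂ[X]) :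
    aeval S.toModule.D r (lift S v x) = lift S v (r * x.1, r * x.2) := by
  rw [lift_apply, lift_apply, map_add, ← S.i_hom.map_aeval, aeval_rankOne_D,
    map_mul (aeval S.toModule.D), Module.End.mul_apply]

theorem p_lift (S : ConformalExtension (rankOne α' Δ') (rankOne α Δ) E) {v : E}
    (hv : S.p v = 1) (x : ℂ[X] × ℂ[X]) : S.p (lift S v x) = x.2 := by
  rw [lift_apply, map_add, S.p_hom.map_aeval, aeval_rankOne_D, hv, mul_one,
    S.isExact.apply_apply_eq_zero, zero_add]

theorem lift_injective (S : ConformalExtension (rankOne α' Δ') (rankOne α Δ) E) {v : E}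
    (hv : S.p v = 1) : Function.Injective (lift S v) := by
  refine (injective_iff_map_eq_zero _).2 fun x hx => ?_
  have h2 : x.2 = 0 := by rw [← p_lift S hv, hx, map_zero]
  rw [lift_apply, h2, map_zero, LinearMap.zero_apply, add_zero] at hx
  exact Prod.ext (S.i_injective (hx.trans (map_zero _).symm)) h2

/-- Freeness of the quotient splits the sequence over ℂ[∂]: subtracting the right multiple of v from
an element leaves something in the image of `S.i`. -/
theorem lift_surjective (S : ConformalExtension (rankOne α' Δ') (rankOne α Δ) E) {v : E}
    (hv : S.p v = 1) : Function.Surjective (lift S v) := by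
  intro e
  obtain ⟨q, hq⟩ := (S.isExact (e - lift S v (0, S.p e))).1 (by rw [map_sub, p_lift S hv, sub_self])
  refine ⟨(q, S.p e), ?_⟩
  rw [lift_apply, hq, lift_apply, map_zero, zero_add, sub_add_cancel]

theorem lift_add_i (S : ConformalExtension (rankOne α' Δ') (rankOne α Δ) E) (v : E) (φ : ℂ[X])
    (x : ℂ[X] × ℂ[X]) : lift S (v + S.i φ) x = lift S v (x.1 + x.2 * φ, x.2) := by
  rw [lift_apply, lift_apply, map_add, map_add, ← S.i_hom.map_aeval, aeval_rankOne_D]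
  abel

/-- `E = ℂ[∂] v' ⊕ ℂ[∂] v` with the action of `L, M, Y` on `v` given by `f, g, h`. -/
structure IsGenerator (S : ConformalExtension (rankOne α' Δ') (rankOne α Δ) E) (v : E)
    (f g h : ℂ[X][X]) : Prop where
  p_eq : S.p v = 1
  act_L : ∀ l, S.toModule.act l (gen .L) v = lift S v (f.eval (C l), X + C α + C (Δ * l))
  act_M : ∀ l, S.toModule.act l (gen .M) v = lift S v (g.eval (C l), 0)
  act_Y : ∀ l, S.toModule.act l (gen .Y) v = lift S v (h.eval (C l), 0)

theorem IsGenerator.act_lift {S : ConformalExtension (rankOne α' Δ') (rankOne α Δ) E} {v : E}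
    {f g h : ℂ[X][X]} (H : IsGenerator S v f g h) (l : ℂ) (a : SV) (x : ℂ[X] × ℂ[X]) :
    S.toModule.act l a (lift S v x) = lift S v (pairAct α α' Δ Δ' f g h l a x) := by
  have hi : S.toModule.act l a (S.i x.1) = lift S v ((rankOne α' Δ').act l a x.1, 0) := by
    rw [← S.i_hom.2, lift_apply, map_zero, LinearMap.zero_apply, add_zero]
  rw [lift_apply, map_add, hi, ConformalModule.act_aeval, act_eq_sum S.toModule, H.act_L, H.act_M, H.act_Y]
  simp only [← map_smul, ← map_add, aeval_lift]
  congr 1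
  ext1
  · simp only [rankOne_act, pairAct, Prod.fst_add, Prod.smul_fst, smul_eq_C_mul]
    ring
  · simp only [pairAct, Prod.snd_add, Prod.smul_snd, smul_eq_C_mul]
    ring

/-- M and Y act by zero on the submodule, so only f notices the change of generator. -/
theorem IsGenerator.add_i {S : ConformalExtension (rankOne α' Δ') (rankOne α Δ) E} {v : E}
    {f g h : ℂ[X][X]} (H : IsGenerator S v f g h) (φ : ℂ[X]) :
    IsGenerator S (v + S.i φ) (f + coboundary α α' Δ Δ' φ) g h := by
  have hi : ∀ l x, S.toModule.act l (gen x) (S.i φ) =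
      lift S v ((rankOne α' Δ').act l (gen x) φ, 0) := fun l x => by
    rw [← S.i_hom.2, lift_apply, map_zero, LinearMap.zero_apply, add_zero]
  refine ⟨?_, fun l => ?_, fun l => ?_, fun l => ?_⟩
  · rw [map_add, H.p_eq, S.isExact.apply_apply_eq_zero, add_zero]
  · rw [map_add, H.act_L, hi, ← map_add, lift_add_i, eval_add, eval_C_coboundary, rankOne_act]
    congr 1
    simp [gen]
    ring
  · rw [map_add, H.act_M, hi, ← map_add, lift_add_i, rankOne_act]
    simp [gen]
  · rw [map_add, H.act_Y, hi, ← map_add, lift_add_i, rankOne_act]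
    simp [gen]

/-- The coordinates of the finitely many coefficients in λ assemble to a polynomial; the second
coordinate is forced by the projection to the quotient. -/
theorem exists_eval_C_eq_fst (S : ConformalExtension (rankOne α' Δ') (rankOne α Δ) E) {v : E}
    (hv : S.p v = 1) (a : SV) : ∃ f : ℂ[X][X], ∀ l,
      S.toModule.act l a v = lift S v (f.eval (C l), (rankOne α Δ).act l a 1) := by
  obtain ⟨n, c, hc⟩ := S.toModule.act_poly a v
  choose x hx using fun j => lift_surjective S hv (c j)
  refine ⟨∑ j ∈ Finset.range n, monomial j (x j).1, fun l => ?_⟩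
  have h : S.toModule.act l a v = lift S v (∑ j ∈ Finset.range n, l ^ j • x j) := by
    rw [hc, map_sum]
    simp only [map_smul, hx]
  rw [h]
  congr 1
  ext1
  · rw [Prod.fst_sum, eval_finsetSum]
    refine Finset.sum_congr rfl fun j _ => ?_
    rw [eval_monomial, Prod.smul_fst, smul_eq_C_mul, C_pow, mul_comm]
  · rw [← p_lift S hv (∑ j ∈ Finset.range n, l ^ j • x j), ← h, S.p_hom.2, hv]

theorem exists_isGenerator (S : ConformalExtension (rankOne α' Δ') (rankOne α Δ) E) :
    ∃ v f g h, IsGenerator S v f g h := by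
  obtain ⟨v, hv⟩ := S.p_surjective 1
  obtain ⟨f, hf⟩ := exists_eval_C_eq_fst S hv (gen .L)
  obtain ⟨g, hg⟩ := exists_eval_C_eq_fst S hv (gen .M)
  obtain ⟨h, hh⟩ := exists_eval_C_eq_fst S hv (gen .Y)
  refine ⟨v, f, g, h, hv, fun l => ?_, fun l => ?_, fun l => ?_⟩
  · rw [hf, rankOne_act]
    simp [gen]
  · rw [hg, rankOne_act]
    simp [gen]
  · rw [hh, rankOne_act]
    simp [gen]

theorem IsGenerator.pairAct_comm {S : ConformalExtension (rankOne α' Δ') (rankOne α Δ) E} {v : E}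
    {f g h : ℂ[X][X]} (H : IsGenerator S v f g h) (l m : ℂ) (a b : SV) (x : ℂ[X] × ℂ[X]) :
    pairAct α α' Δ Δ' f g h l a (pairAct α α' Δ Δ' f g h m b x)
      - pairAct α α' Δ Δ' f g h m b (pairAct α α' Δ Δ' f g h l a x)
      = pairAct α α' Δ Δ' f g h (l + m) (bracketFun l a b) x := by
  apply lift_injective S H.p_eq
  rw [map_sub, ← H.act_lift, ← H.act_lift, ← H.act_lift, ← H.act_lift, ← H.act_lift]
  exact S.toModule.act_comm l m a b _

theorem IsGenerator.isCocycle {S : ConformalExtension (rankOne α' Δ') (rankOne α Δ) E} {v : E}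
    {f g h : ℂ[X][X]} (H : IsGenerator S v f g h) : IsCocycle α α' Δ Δ' f := by
  intro x l m
  have e := congrArg (fun y => y.1.eval x) (H.pairAct_comm l m (gen .L) (gen .L) (0, 1))
  simp [pairAct, bracketFun_L, bracketFun_M, bracketFun_Y, gen] at e
  rw [← C_add] at e
  simp only [evalEval]
  linear_combination e

theorem IsGenerator.isYCocycle {S : ConformalExtension (rankOne α' Δ') (rankOne α Δ) E} {v : E}
    {f g h : ℂ[X][X]} (H : IsGenerator S v f g h) : IsYCocycle α α' Δ Δ' h := by
  intro x l m
  have e := congrArg (fun y => y.1.eval x) (H.pairAct_comm l m (gen .L) (gen .Y) (0, 1))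
  simp [pairAct, bracketFun_L, bracketFun_M, bracketFun_Y, gen] at e
  rw [← C_add] at e
  simp only [evalEval]
  linear_combination e

theorem IsGenerator.g_eq_zero {S : ConformalExtension (rankOne α' Δ') (rankOne α Δ) E} {v : E}
    {f g h : ℂ[X][X]} (H : IsGenerator S v f g h) : g = 0 := by
  refine eq_of_forall_evalEval_eq fun x l => ?_
  -- [Y, Y] gives (λ - μ) g(∂, λ + μ) = 0; these values have sum l and difference 2.
  have e := congrArg (fun y => y.1.eval x)
    (H.pairAct_comm (l / 2 + 1) (l / 2 - 1) (gen .Y) (gen .Y) (0, 1))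
  simp [pairAct, bracketFun_L, bracketFun_M, bracketFun_Y, gen] at e
  rcases e with e | e
  · exact absurd e (by ring_nf; norm_num)
  · simpa [evalEval] using e

/-- Both extensions are copies of the same `pairAct` on ℂ[∂] ⊕ ℂ[∂], so matching the generators is a
homomorphism. -/
theorem IsGenerator.equivalent {S : ConformalExtension (rankOne α' Δ') (rankOne α Δ) E} {v : E}
    {T : ConformalExtension (rankOne α' Δ') (rankOne α Δ) E'} {w : E'}
    {f g h : ℂ[X][X]} (H : IsGenerator S v f g h) (K : IsGenerator T w f g h) :
    S.Equivalent T := by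
  let e := LinearEquiv.ofBijective (lift S v)
    ⟨lift_injective S H.p_eq, lift_surjective S H.p_eq⟩
  have he : ∀ x, e.symm (lift S v x) = x := e.symm_apply_apply
  refine ⟨(lift T w).comp e.symm.toLinearMap, ⟨fun y => ?_, fun l a y => ?_⟩, fun q => ?_,
    fun y => ?_⟩
  · obtain ⟨x, rfl⟩ := lift_surjective S H.p_eq y
    have h1 := aeval_lift S v X x
    have h2 := aeval_lift T w X x
    rw [aeval_X] at h1 h2
    simp only [LinearMap.comp_apply, LinearEquiv.coe_coe, h1, he, h2]
  · obtain ⟨x, rfl⟩ := lift_surjective S H.p_eq y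
    simp only [LinearMap.comp_apply, LinearEquiv.coe_coe, H.act_lift, K.act_lift, he]
  · have h1 : S.i q = lift S v (q, 0) := by simp [lift_apply]
    simp only [LinearMap.comp_apply, LinearEquiv.coe_coe, h1, he]
    simp [lift_apply]
  · obtain ⟨x, rfl⟩ := lift_surjective S H.p_eq y
    simp only [LinearMap.comp_apply, LinearEquiv.coe_coe, he, p_lift S H.p_eq, p_lift T K.p_eq]

theorem map_lift {S : ConformalExtension (rankOne α' Δ') (rankOne α Δ) E}
    {T : ConformalExtension (rankOne α' Δ') (rankOne α Δ) E'} {ψ : E →ₗ[ℂ] E'}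
    (hψ : S.toModule.IsHom T.toModule ψ) (hi : ∀ q, ψ (S.i q) = T.i q) (v : E)
    (x : ℂ[X] × ℂ[X]) : ψ (lift S v x) = lift T (ψ v) x := by
  rw [lift_apply, lift_apply, map_add, hi, hψ.map_aeval]

theorem IsGenerator.map {S : ConformalExtension (rankOne α' Δ') (rankOne α Δ) E} {v : E}
    {T : ConformalExtension (rankOne α' Δ') (rankOne α Δ) E'} {f g h : ℂ[X][X]}
    (H : IsGenerator S v f g h) {ψ : E →ₗ[ℂ] E'} (hψ : S.toModule.IsHom T.toModule ψ)
    (hi : ∀ q, ψ (S.i q) = T.i q) (hp : ∀ e, T.p (ψ e) = S.p e) :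
    IsGenerator T (ψ v) f g h := by
  refine ⟨by rw [hp, H.p_eq], fun l => ?_, fun l => ?_, fun l => ?_⟩
  · rw [← hψ.2, H.act_L, map_lift hψ hi]
  · rw [← hψ.2, H.act_M, map_lift hψ hi]
  · rw [← hψ.2, H.act_Y, map_lift hψ hi]

theorem IsGenerator.unique {S : ConformalExtension (rankOne α' Δ') (rankOne α Δ) E} {v : E}
    {f g h f' g' h' : ℂ[X][X]} (H : IsGenerator S v f g h) (H' : IsGenerator S v f' g' h') :
    f = f' ∧ h = h' := by
  constructor
  · refine eq_of_forall_eval_eq C C_injective fun l => ?_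
    exact congrArg Prod.fst (lift_injective S H.p_eq ((H.act_L l).symm.trans (H'.act_L l)))
  · refine eq_of_forall_eval_eq C C_injective fun l => ?_
    exact congrArg Prod.fst (lift_injective S H.p_eq ((H.act_Y l).symm.trans (H'.act_Y l)))

theorem isGenerator_directSum : IsGenerator
    (ConformalExtension.directSum (rankOne α' Δ') (rankOne α Δ)) (0, 1) 0 0 0 := by
  have hD : ∀ p : ℂ[X], aeval (ConformalExtension.directSum (rankOne α' Δ')
      (rankOne α Δ)).toModule.D p ((0, 1) : ℂ[X] × ℂ[X]) = (0, p) := fun p => by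
    have h := (ConformalModule.IsHom.map_aeval (MV := rankOne α Δ)
      (MW := (ConformalExtension.directSum (rankOne α' Δ') (rankOne α Δ)).toModule)
      (φ := LinearMap.inr ℂ ℂ[X] ℂ[X]) ⟨fun v => ?_, fun l a v => ?_⟩ p 1).symm
    · rw [aeval_rankOne_D, mul_one] at h
      exact h
    · simp [ConformalExtension.directSum, ConformalModule.prod]
    · simp [ConformalExtension.directSum, ConformalModule.prod]
  refine ⟨rfl, fun l => ?_, fun l => ?_, fun l => ?_⟩
  all_goals
    rw [lift_apply, hD]
    simp [ConformalExtension.directSum, ConformalModule.prod, rankOne_act, gen]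

/-- An equivalence with the direct sum sends v to (0, 1) plus some φ(∂)v'. The polynomials of v are
thus those of the generator (0, 1), all zero, after a change of generator. -/
theorem IsGenerator.exists_eq_coboundary_of_isTrivial
    {S : ConformalExtension (rankOne α' Δ') (rankOne α Δ) E} {v : E} {f g h : ℂ[X][X]}
    (H : IsGenerator S v f g h) (hS : S.IsTrivial) :
    (∃ φ, f = coboundary α α' Δ Δ' φ) ∧ h = 0 := by
  obtain ⟨ψ, hψ, hi, hp⟩ := hS
  have K := H.map hψ hi hp
  have h2 : (ψ v).2 = 1 := K.p_eq
  have hv : ψ v = (0, 1) + (ConformalExtension.directSum (rankOne α' Δ') (rankOne α Δ)).i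
      (ψ v).1 := by
    ext1
    · simp [ConformalExtension.directSum]
    · simp [ConformalExtension.directSum, h2]
  have K' := isGenerator_directSum.add_i (α := α) (α' := α') (Δ := Δ) (Δ' := Δ') (ψ v).1
  rw [← hv, zero_add] at K'
  exact ⟨⟨_, (K.unique K').1⟩, (K.unique K').2⟩

end Generator

theorem aeval_eq_mul_of_D {N : Module.End ℂ (ℂ[X] × ℂ[X])}
    (hN : ∀ q p, N (q, p) = (X * q, X * p)) (r q p : ℂ[X]) :
    aeval N r (q, p) = (r * q, r * p) := by
  induction r using Polynomial.induction_on generalizing q p with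
  | C c => simp [smul_eq_C_mul]
  | add r s hr hs => simp [hr, hs, add_mul]
  | monomial n c ih =>
    rw [pow_succ, ← mul_assoc, aeval_mul_X_apply, hN, ih]
    simp only [mul_assoc]

theorem IsGivenBy.isGenerator {α Δ α' Δ' : ℂ}
    {S : ConformalExtension (rankOne α' Δ') (rankOne α Δ) (ℂ[X] × ℂ[X])} {f g h : ℂ[X][X]}
    (H : IsGivenBy S f g h) : IsGenerator S (0, 1) f g h := by
  obtain ⟨hi, hp, hD, hL, hM, hY⟩ := H
  have hl : ∀ x, lift S (0, 1) x = x := fun x => by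
    rw [lift_apply, aeval_eq_mul_of_D hD, hi]
    simp
  refine ⟨by rw [hp]; rfl, fun l => ?_, fun l => ?_, fun l => ?_⟩
  · rw [hL, hl]
  · rw [hM, hl]
  · rw [hY, hl]

/-! ### The extension given by a pair of cocycles -/

/-- The first coordinate of the commutator identity is a combination of the conditions for the pairs
(L, L), (L, Y) and (Y, L), the last with λ and μ exchanged. With g = 0 every other pair contributes
nothing. -/
theorem pairAct_zero_comm {α α' Δ Δ' : ℂ} {f h : ℂ[X][X]} (hf : IsCocycle α α' Δ Δ' f)
    (hh : IsYCocycle α α' Δ Δ' h) (l m : ℂ) (a b : SV) (x : ℂ[X] × ℂ[X]) :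
    pairAct α α' Δ Δ' f 0 h l a (pairAct α α' Δ Δ' f 0 h m b x)
      - pairAct α α' Δ Δ' f 0 h m b (pairAct α α' Δ Δ' f 0 h l a x)
      = pairAct α α' Δ Δ' f 0 h (l + m) (bracketFun l a b) x := by
  have e1 : ∀ r : ℂ, r + m + l = r + l + m := fun r => by ring
  have e2 : ∀ r : ℂ, r + (l + m) = r + l + m := fun r => by ring
  have e3 : -(l + m) + l = -m := by ring
  ext1
  · refine Polynomial.funext fun r => ?_
    simp only [pairAct, bracketFun_L, bracketFun_Y, Prod.fst_sub, eval_sub,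
      eval_add, eval_mul, eval_comp, eval_X, eval_C, eval_zero, e1, e2, e3]
    have c1 := hf r l m
    have c2 := hh r l m
    have c3 := hh r m l
    simp only [evalEval, add_comm m l] at c1 c2 c3
    linear_combination x.2.eval (r + l + m) *
      ((a .L).eval (-l) * (b .L).eval (-m) * c1 + (a .L).eval (-l) * (b .Y).eval (-m) * c2
        - (a .Y).eval (-l) * (b .L).eval (-m) * c3)
  · refine Polynomial.funext fun r => ?_
    simp only [pairAct, bracketFun_L, Prod.snd_sub, eval_sub,
      eval_add, eval_mul, eval_comp, eval_X, eval_C, e1, e2, e3]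
    ring

theorem pairAct_poly (α α' Δ Δ' : ℂ) (f g h : ℂ[X][X]) (a : SV) (x : ℂ[X] × ℂ[X]) :
    ∃ (n : ℕ) (c : ℕ → ℂ[X] × ℂ[X]),
      ∀ l : ℂ, pairAct α α' Δ Δ' f g h l a x = ∑ j ∈ Finset.range n, l ^ j • c j := by
  obtain ⟨P, hP⟩ : ∃ P : ℂ[X][X], P = ((a .L).map C).comp (-X) *
      ((x.1.map C).comp (C X + X) * (C X + C (C α') + C (C Δ') * X)
        + (x.2.map C).comp (C X + X) * f)
      + ((a .M).map C).comp (-X) * ((x.2.map C).comp (C X + X) * g)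
      + ((a .Y).map C).comp (-X) * ((x.2.map C).comp (C X + X) * h) := ⟨_, rfl⟩
  obtain ⟨Q, hQ⟩ : ∃ Q : ℂ[X][X], Q = ((a .L).map C).comp (-X) *
      ((x.2.map C).comp (C X + X) * (C X + C (C α) + C (C Δ) * X)) := ⟨_, rfl⟩
  refine ⟨max P.natDegree Q.natDegree + 1, fun j => (P.coeff j, Q.coeff j), fun l => ?_⟩
  have h1 := eval_eq_sum_range' (Nat.lt_succ_of_le (le_max_left P.natDegree Q.natDegree)) (C l)
  have h2 := eval_eq_sum_range' (Nat.lt_succ_of_le (le_max_right P.natDegree Q.natDegree)) (C l)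
  ext1
  · simp only [Prod.fst_sum, Prod.smul_fst, smul_eq_C_mul, C_pow, mul_comm (C l ^ _)]
    rw [← h1, hP]
    simp [pairAct, eval_comp, eval_map_C, comp_C']
  · simp only [Prod.snd_sum, Prod.smul_snd, smul_eq_C_mul, C_pow, mul_comm (C l ^ _)]
    rw [← h2, hQ]
    simp [pairAct, eval_comp, eval_map_C, comp_C']

/-- The conformal module structure on `ℂ[∂] v' ⊕ ℂ[∂] v` given by `f` and `h`. -/
noncomputable def pairModule {α α' Δ Δ' : ℂ} {f h : ℂ[X][X]} (hf : IsCocycle α α' Δ Δ' f)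
    (hh : IsYCocycle α α' Δ Δ' h) : ConformalModule conformalAlgebra (ℂ[X] × ℂ[X]) where
  D := (LinearMap.mulLeft ℂ X).prodMap (LinearMap.mulLeft ℂ X)
  act l := LinearMap.mk₂ ℂ (pairAct α α' Δ Δ' f 0 h l)
    (by intros; ext1 <;> simp [pairAct] <;> ring)
    (by intros; ext1 <;> simp [pairAct, smul_eq_C_mul] <;> ring)
    (by intros; ext1 <;> simp [pairAct] <;> ring)
    (by intros; ext1 <;> simp [pairAct, smul_eq_C_mul] <;> ring)
  act_poly := pairAct_poly α α' Δ Δ' f 0 h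
  act_comm := pairAct_zero_comm hf hh
  act_D l a x := by
    ext1 <;> simp [pairAct, conformalAlgebra, D_apply, smul_eq_C_mul] <;> ring
  D_act l a x := by
    ext1 <;> simp [pairAct, smul_eq_C_mul] <;> ring

/-- The extension given by `f` and `h`. -/
noncomputable def pairExtension {α α' Δ Δ' : ℂ} {f h : ℂ[X][X]} (hf : IsCocycle α α' Δ Δ' f)
    (hh : IsYCocycle α α' Δ Δ' h) :
    ConformalExtension (rankOne α' Δ') (rankOne α Δ) (ℂ[X] × ℂ[X]) where
  toModule := pairModule hf hh
  i := LinearMap.inl ℂ ℂ[X] ℂ[X]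
  p := LinearMap.snd ℂ ℂ[X] ℂ[X]
  i_hom := by
    constructor
    · intro v
      ext1 <;> simp [pairModule, rankOne]
    · intro l a v
      ext1 <;> simp [pairModule, pairAct, rankOne_act]
      ring
  p_hom := by
    constructor
    · intro v
      simp [pairModule, rankOne]
    · intro l a v
      simp [pairModule, pairAct, rankOne_act]
      ring
  i_injective := LinearMap.inl_injective
  p_surjective := LinearMap.snd_surjective
  isExact := Function.Exact.inl_snd

theorem isGivenBy_pairExtension {α α' Δ Δ' : ℂ} {f h : ℂ[X][X]} (hf : IsCocycle α α' Δ Δ' f)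
    (hh : IsYCocycle α α' Δ Δ' h) : IsGivenBy (pairExtension hf hh) f 0 h := by
  refine ⟨rfl, rfl, fun q p => rfl, fun l => ?_, fun l => ?_, fun l => ?_⟩
  all_goals simp [pairExtension, pairModule, pairAct, gen]

/-! ### The classification -/

theorem isYCocycle_zero (α α' Δ Δ' : ℂ) : IsYCocycle α α' Δ Δ' 0 := by
  intro x l m
  simp

theorem ExtensionList.cocycles {α Δ Δ' : ℂ} {f g h : ℂ[X][X]}
    (H : ExtensionList α Δ Δ' f g h) :
    IsCocycle α α Δ Δ' f ∧ g = 0 ∧ IsYCocycle α α Δ Δ' h := by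
  cases H with
  | virasoro f hf => exact ⟨hf.isCocycle, rfl, isYCocycle_zero α α Δ Δ'⟩
  | neg_half a ha hΔ =>
    refine ⟨isCocycle_zero α α Δ Δ', rfl, fun x l m => ?_⟩
    obtain rfl : Δ = Δ' - 1 / 2 := by linear_combination hΔ
    simp only [evalEval_const]
    ring
  | half a ha hΔ =>
    refine ⟨isCocycle_zero α α Δ Δ', rfl, fun x l m => ?_⟩
    obtain rfl : Δ = Δ' + 1 / 2 := by linear_combination hΔ
    simp only [evalEval_const, evalEval_mul, evalEval_add, evalEval_dbar, evalEval_lam]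
    ring
  | three_halves a ha hΔ hΔ' =>
    refine ⟨isCocycle_zero α α Δ Δ', rfl, fun x l m => ?_⟩
    subst hΔ hΔ'
    simp only [evalEval_const, evalEval_mul, evalEval_sub, evalEval_pow, evalEval_dbar,
      evalEval_lam]
    ring

theorem ExtensionList.not_coboundary {α Δ Δ' : ℂ} (hΔ' : Δ' ≠ 0) {f g h : ℂ[X][X]}
    (H : ExtensionList α Δ Δ' f g h) :
    ¬ ((∃ φ, f = coboundary α α Δ Δ' φ) ∧ h = 0) := by
  rintro ⟨⟨φ, hφ⟩, h0⟩
  cases H with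
  | virasoro f hf => exact hf.ne_coboundary hΔ' φ hφ
  | neg_half a ha hΔ =>
    have e := congrArg (evalEval 0 0) h0
    rw [evalEval_const, evalEval_zero] at e
    exact ha e
  | half a ha hΔ =>
    -- At this point ∂ + α = 1 and λ = 0, so h takes the value a.
    have e := congrArg (evalEval (1 - α) 0) h0
    simp only [evalEval_const, evalEval_mul, evalEval_add, evalEval_dbar, evalEval_lam,
      evalEval_zero] at e
    exact ha (by linear_combination e)
  | three_halves a ha hΔ hΔ' =>
    have e := congrArg (evalEval (1 - α) 0) h0
    simp only [evalEval_const, evalEval_mul, evalEval_sub, evalEval_pow, evalEval_dbar,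
      evalEval_lam, evalEval_zero] at e
    exact ha (by linear_combination e)

theorem VirasoroList.sub_mem {α Δ Δ' : ℂ} {f : ℂ[X][X]} (hf : VirasoroList α Δ Δ' f) :
    Δ - Δ' ∈ ({0, 2, 3, 4, 5, 6} : Set ℂ) := by
  simp only [Set.mem_insert_iff, Set.mem_singleton_iff]
  cases hf with
  | zero c₀ c₁ hc hΔ => exact Or.inl (sub_eq_zero.2 hΔ)
  | two c hc hΔ => simp [hΔ]
  | three c hc hΔ => simp [hΔ]
  | four c hc hΔ => simp [hΔ]
  | five c hc hΔ hΔ' => rw [hΔ, hΔ']; norm_num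
  | six c s hc hs hΔ hΔ' => rw [hΔ, hΔ']; ring_nf; simp

end SV

theorem mainTheorem4 (α α' Δ Δ' : ℂ) (hΔ : Δ ≠ 0) (hΔ' : Δ' ≠ 0) :
    (∀ (E : Type*) [AddCommGroup E] [Module ℂ E]
      (S : ConformalExtension (SV.rankOne α' Δ') (SV.rankOne α Δ) E), ¬ S.IsTrivial →
        α = α' ∧ Δ - Δ' ∈ ({0, 2, 3, 4, 5, 6, 1 / 2, -1 / 2, 3 / 2} : Set ℂ) ∧
        ∃ (f g h : ℂ[X][X])
          (T : ConformalExtension (SV.rankOne α' Δ') (SV.rankOne α Δ) (ℂ[X] × ℂ[X])),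
          SV.ExtensionList α Δ Δ' f g h ∧ SV.IsGivenBy T f g h ∧ S.Equivalent T) ∧
    (α = α' → ∀ f g h : ℂ[X][X], SV.ExtensionList α Δ Δ' f g h →
      (∃ T : ConformalExtension (SV.rankOne α' Δ') (SV.rankOne α Δ) (ℂ[X] × ℂ[X]),
        SV.IsGivenBy T f g h) ∧
      ∀ T : ConformalExtension (SV.rankOne α' Δ') (SV.rankOne α Δ) (ℂ[X] × ℂ[X]),
        SV.IsGivenBy T f g h → ¬ T.IsTrivial) := by
  refine ⟨?_, ?_⟩
  · intro E _ _ S hS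
    obtain ⟨v, f, g, h, H⟩ := SV.exists_isGenerator S
    obtain rfl := H.g_eq_zero
    have trivial_of : ∀ φ, f = SV.coboundary α α' Δ Δ' φ → h = 0 → False := by
      intro φ hφ hh
      have K := H.add_i (-φ)
      rw [hφ, ← SV.coboundary_add, add_neg_cancel, hh,
        show SV.coboundary α α' Δ Δ' 0 = 0 by simp [SV.coboundary]] at K
      exact hS (K.equivalent SV.isGenerator_directSum)
    by_cases hα : α = α'
    swap
    · obtain ⟨φ, hφ⟩ := H.isCocycle.exists_eq_coboundary_of_ne hα
      exact (trivial_of φ hφ (H.isYCocycle.eq_zero_of_ne hα)).elim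
    subst hα
    obtain ⟨φ, hφ⟩ := H.isCocycle.exists_sub_coboundary hΔ'
    have K := H.add_i (-φ)
    have hneg : f + SV.coboundary α α Δ Δ' (-φ) = f - SV.coboundary α α Δ Δ' φ := by
      rw [sub_eq_add_neg]
      congr 1
      simp only [SV.coboundary, map_neg]
      ring
    rw [hneg] at K
    rcases H.isYCocycle.eq_zero_or_extensionList hΔ' with rfl | ⟨hh, hd⟩
    · rcases hφ with hφ | hφ
      · exact (trivial_of φ (sub_eq_zero.1 hφ) rfl).elim
      · have hT := SV.isGivenBy_pairExtension hφ.isCocycle (SV.isYCocycle_zero α α Δ Δ')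
        refine ⟨rfl, ?_, _, 0, 0, _, .virasoro Δ Δ' _ hφ, hT, K.equivalent hT.isGenerator⟩
        have := hφ.sub_mem
        simp only [Set.mem_insert_iff, Set.mem_singleton_iff] at this
        rcases this with h | h | h | h | h | h <;> simp [h]
    -- A nonzero h makes Δ - Δ' a half-integer, while a listed f makes it an integer; hence f is a
    -- coboundary.
    · have hφ0 : f - SV.coboundary α α Δ Δ' φ = 0 := by
        refine hφ.resolve_right fun hV => ?_
        have hm := hV.sub_mem
        simp only [Set.mem_insert_iff, Set.mem_singleton_iff] at hm
        rcases hd with hd | hd | hd <;> rw [hd] at hm <;> norm_num at hm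
      rw [hφ0] at K
      have hT := SV.isGivenBy_pairExtension (SV.isCocycle_zero α α Δ Δ') hh.cocycles.2.2
      refine ⟨rfl, ?_, 0, 0, h, _, hh, hT, K.equivalent hT.isGenerator⟩
      rcases hd with hd | hd | hd <;> simp [hd]
  · rintro rfl f g h H
    obtain ⟨hf, rfl, hh⟩ := H.cocycles
    exact ⟨⟨_, SV.isGivenBy_pairExtension hf hh⟩, fun T hT hTr =>
      H.not_coboundary hΔ' (hT.isGenerator.exists_eq_coboundary_of_isTrivial hTr)⟩
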